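/- Let $0<c\le 1$ and let $p=(p_x)_{x\in\mathbb Z}$ satisfy $c<p_x\le 1$ for all $x\in\mathbb Z$ and $\liminf_{x\to-\infty}p_x=c$. Consider the totally asymmetric zero-range process $(\eta_t)_{t\ge 0}$ on $\mathbf X=\mathbb N^{\mathbb Z}$ with rates $p$: given independent Poisson processes $N_x$, $x\in\mathbb Z$, of rates $p_x$, independent of the initial configuration $\eta_0$, whenever $N_x$ jumps at a time $t$ with $\eta_{t-}(x)>0$, one particle is moved from $x$ to $x+1$. For a probability measure $\nu$ on $\mathbf X$ let $\nu S_p(t)$ denote the law of $\eta_t$ when $\eta_0$ has law $\nu$; $\nu$ is called invariant if $\nu S_p(t)=\nu$ for all $t\ge 0$. Let $\nu_{p,c}$ be the product measure on $\mathbf X$ with marginals $$\nu_{p,c}\{\xi:\xi(x)=k\}=\Bigl(\frac{c}{p_x}\Bigr)^k\Bigl(1-\frac{c}{p_x}\Bigr),\qquad x\in\mathbb Z,\ k\in\mathbb N.$$ For probability measures $\mu,\mu'$ on $\mathbf X$, say that $\mu'$ dominates $\mu$ if $\int f\,d\mu\le\int f\,d\mu'$ for every bounded function $f:\mathbf X\to\mathbb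 R$ that depends on finitely many coordinates and is increasing for the coordinatewise order. Then, for every probability measure $\nu$ on $\mathbf X$: (i) the family $\{\nu S_p(t):t>0\}$ is tight; (ii) every weak limit of $\nu S_p(t)$ as $t\to\infty$, that is, every probability measure $\mu$ on $\mathbf X$ such that $\nu S_p(t_n)\to\mu$ weakly for some sequence $t_n\to\infty$, is dominated by $\nu_{p,c}$; (iii) if $\nu$ is invariant, then $\nu$ is dominated by $\nu_{p,c}$. -/

import Mathlib

open MeasureTheory ProbabilityTheory Filter Topology
open scoped NNReal ENNReal

namespace ZeroRange

/-- The configuration space `ℕ^ℤ`: `ξ x` is the number of particles at the site `x`. It carries the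
product topology of the discrete topologies and the product `σ`-algebra. -/
abbrev Config : Type := ℤ → ℕ

/-- The product measure `ν_{p,v}` on `ℕ^ℤ` whose marginal at `x` gives the value `k` the mass
`(v / p x) ^ k * (1 - v / p x)`; it is a probability measure when `0 ≤ v < p x` for all `x`. -/
noncomputable def productMeasure (p : ℤ → ℝ) (v : ℝ) : Measure Config :=
  Measure.infinitePi fun x : ℤ =>
    Measure.sum fun k : ℕ =>
      ENNReal.ofReal ((v / p x) ^ k * (1 - v / p x)) • (Measure.dirac k : Measure ℕ)

/-- The standard partial order: `ν` dominates `μ` if `∫ f dμ ≤ ∫ f dν` for every bounded increasing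
function `f` that depends on finitely many coordinates only. Such an `f` is automatically
measurable, because a finite power of `ℕ` is countable. -/
def DominatedBy (μ ν : Measure Config) : Prop :=
  ∀ f : Config → ℝ, Monotone f → (∃ C : ℝ, ∀ ξ, |f ξ| ≤ C) →
    (∃ A : Finset ℤ, DependsOn f (A : Set ℤ)) → ∫ ξ, f ξ ∂μ ≤ ∫ ξ, f ξ ∂ν

section Dynamics

variable {Ω : Type*} [mΩ : MeasurableSpace Ω]

/-- `N` is a Poisson process of rate `r`: it starts at `0`, its increments are independent and
Poisson distributed, and its paths are nondecreasing and right-continuous. -/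
structure IsPoissonProcess (r : ℝ≥0) (N : ℝ≥0 → Ω → ℕ) (P : Measure Ω) : Prop where
  measurable : ∀ t, Measurable (N t)
  zero : ∀ᵐ ω ∂P, N 0 ω = 0
  paths : ∀ᵐ ω ∂P, (Monotone fun t => N t ω) ∧
    ∀ t, ContinuousWithinAt (fun s => N s ω) (Set.Ici t) t
  indep_increments : HasIndepIncrements N P
  increment_law : ∀ s t : ℝ≥0, s ≤ t →
    P.map (fun ω => N t ω - N s ω) = poissonMeasure (r * (t - s))

/-- The path `n` jumps at the time `s`: it is not constantly equal to `n s` just before `s`. -/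
def JumpsAt (n : ℝ≥0 → ℕ) (s : ℝ≥0) : Prop :=
  ¬ ∀ᶠ r in 𝓝[<] s, n r = n s

/-- The number of particles that leave a site during `(0, t]`, when `n` is the path of the clock of
that site and `e` is the path of its number of particles: the number of jump times `s ∈ (0, t]` of
`n` at which the site is occupied just before `s`. -/
noncomputable def departures (n e : ℝ≥0 → ℕ) (t : ℝ≥0) : ℕ :=
  Set.ncard {s : ℝ≥0 | 0 < s ∧ s ≤ t ∧ JumpsAt n s ∧ ∀ᶠ r in 𝓝[<] s, 0 < e r}

/-- `η` is the totally asymmetric zero-range process in the environment `p` driven by the clocks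
`N x`. The clocks are independent Poisson processes, `N x` having rate `p x`, and whenever `N x`
jumps at a time at which `x` is occupied just before, one particle moves from `x` to `x + 1`.
Nothing else happens: the content of `x` at time `t` is the initial content, plus the departures
from `x - 1`, minus the departures from `x`. The filtration `ℱ` expresses that the configuration at
time `t` does not look into the future of the clocks (in particular the initial configuration is
independent of the clocks); one may take for `ℱ t` the (completed) `σ`-algebra generated by the
initial configuration and the clocks up to time `t`. -/
structure IsZeroRangeProcess (p : ℤ → ℝ) (ℱ : Filtration ℝ≥0 mΩ) (N : ℤ → ℝ≥0 → Ω → ℕ)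
    (η : ℝ≥0 → Ω → Config) (P : Measure Ω) : Prop where
  poisson : ∀ x, IsPoissonProcess (p x).toNNReal (N x) P
  indep_clocks : iIndepFun (fun (x : ℤ) (ω : Ω) (t : ℝ≥0) => N x t ω) P
  adapted_clocks : ∀ x t, Measurable[ℱ t] (N x t)
  adapted : ∀ t, Measurable[ℱ t] (η t)
  indep_future : ∀ t : ℝ≥0,
    Indep (ℱ t)
      (MeasurableSpace.comap (fun (ω : Ω) (x : ℤ) (u : ℝ≥0) => N x (t + u) ω - N x t ω)
        MeasurableSpace.pi) P
  evolution : ∀ᵐ ω ∂P, ∀ (t : ℝ≥0) (x : ℤ),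
    η t ω x + departures (N x · ω) (η · ω x) t =
      η 0 ω x + departures (N (x - 1) · ω) (η · ω (x - 1)) t

/-- The law of the process at time `t`: this is `ν S_p(t)` when `ν` is the law at time `0`. -/
noncomputable def IsZeroRangeProcess.law {p : ℤ → ℝ} {ℱ : Filtration ℝ≥0 mΩ}
    {N : ℤ → ℝ≥0 → Ω → ℕ} {η : ℝ≥0 → Ω → Config} {P : Measure Ω} [IsProbabilityMeasure P]
    (h : IsZeroRangeProcess p ℱ N η P) (t : ℝ≥0) : ProbabilityMeasure Config :=
  ⟨P.map (η t),
    Measure.isProbabilityMeasure_map ((h.adapted t).mono (ℱ.le t) le_rfl).aemeasurable⟩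

end Dynamics

end ZeroRange

/-! Choose a site `x` whose rate is strictly below the rates on the window `(x, K]`. Inside the
window the process receives particles only when the clock at `x` rings, so it lies below a tandem of
queues in which `x` is an inexhaustible source: every ring at `x` injects a particle, and particles
leaving `K` disappear. This tandem has an invariant product law, geometric with parameter `p x / p
z` at `z`, and converges to it from every configuration. Hence every limit of the process on the
window is dominated by that law. Since `c < p z` for all `z` and `liminf p = c` at `-∞`, such sites
`x` exist arbitrarily far to the left with `p x` arbitrarily close to `c`, and continuity in the
parameter gives `productMeasure p c`.

The comparison is carried out on expectations of increasing functions, with an Euler scheme in place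
of a coupling. Over a time `u` the process is dominated by one Euler step of the tandem up to an
error of order `u ^ 2` (`integral_le_step`); hops are monotone, so this iterates
(`integral_le_pow`). With `n` steps of size `t / n` the total error is of order `1 / n`. A small
Euler step is a mixture of idling and an Euler step of fixed size (`eulerStep_mul_pow`), so the `n`
steps amount to a binomial number, with mean proportional to `t`, of steps of one fixed discrete
chain. Only the ergodic theorem for that chain is then needed (`tendsto_eulerStep_pow`), and it
follows from the decay of the `L²` norm under the invariant law.

Tightness uses the same comparison: invariance bounds the tandem from a fixed configuration by the
stationary mean divided by the mass of that configuration, uniformly in time. -/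

namespace ZeroRange

/-! ### Euler schemes of finite-rate jump processes -/

section Euler

variable {S ι : Type*}

/-- The generator of the pure jump process that performs the jump `T i` at rate `a i`, `i ∈ J`. -/
noncomputable def jumpGenerator (J : Finset ι) (a : ι → ℝ) (T : ι → S → S) :
    Module.End ℝ (S → ℝ) :=
  ∑ i ∈ J, a i • (LinearMap.funLeft ℝ ℝ (T i) - 1)

theorem jumpGenerator_apply (J : Finset ι) (a : ι → ℝ) (T : ι → S → S) (g : S → ℝ) (ξ : S) :
    jumpGenerator J a T g ξ = ∑ i ∈ J, a i * (g (T i ξ) - g ξ) := by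
  simp [jumpGenerator, LinearMap.sum_apply, Finset.sum_apply, LinearMap.funLeft_apply]

/-- The transition operator of the Euler scheme with step `h` of a pure jump process. -/
noncomputable def eulerStep (J : Finset ι) (a : ι → ℝ) (T : ι → S → S) (h : ℝ) :
    Module.End ℝ (S → ℝ) :=
  1 + h • jumpGenerator J a T

variable {J : Finset ι} {a : ι → ℝ} {T : ι → S → S} {h : ℝ}

theorem eulerStep_apply (g : S → ℝ) (ξ : S) :
    eulerStep J a T h g ξ = (1 - h * ∑ i ∈ J, a i) * g ξ + ∑ i ∈ J, h * a i * g (T i ξ) := by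
  simp only [eulerStep, LinearMap.add_apply, Module.End.one_apply, LinearMap.smul_apply,
    Pi.add_apply, Pi.smul_apply, jumpGenerator_apply, smul_eq_mul, mul_sub, Finset.sum_sub_distrib,
    Finset.mul_sum, sub_mul, mul_assoc, one_mul, Finset.sum_mul]
  ring

/-- The weights `1 - h * ∑ a i` and `h * a i` are nonnegative with sum one, so an Euler step is an
average. -/
theorem eulerStep_mem_Icc (ha : ∀ i ∈ J, 0 ≤ a i) (h0 : 0 ≤ h) (h1 : h * ∑ i ∈ J, a i ≤ 1)
    {g : S → ℝ} {l u : ℝ} (hg : ∀ ξ, g ξ ∈ Set.Icc l u) (ξ : S) :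
    eulerStep J a T h g ξ ∈ Set.Icc l u := by
  rw [eulerStep_apply]
  have hl : ∀ v : ℝ, v = (1 - h * ∑ i ∈ J, a i) * v + ∑ i ∈ J, h * a i * v := fun v => by
    rw [← Finset.sum_mul, ← Finset.mul_sum]; ring
  constructor
  · rw [hl l]
    exact add_le_add (mul_le_mul_of_nonneg_left (hg ξ).1 (by linarith))
      (Finset.sum_le_sum fun i hi =>
        mul_le_mul_of_nonneg_left (hg _).1 (mul_nonneg h0 (ha i hi)))
  · rw [hl u]
    exact add_le_add (mul_le_mul_of_nonneg_left (hg ξ).2 (by linarith))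
      (Finset.sum_le_sum fun i hi =>
        mul_le_mul_of_nonneg_left (hg _).2 (mul_nonneg h0 (ha i hi)))

theorem eulerStep_pow_mem_Icc (ha : ∀ i ∈ J, 0 ≤ a i) (h0 : 0 ≤ h) (h1 : h * ∑ i ∈ J, a i ≤ 1)
    {g : S → ℝ} {l u : ℝ} (hg : ∀ ξ, g ξ ∈ Set.Icc l u) (n : ℕ) (ξ : S) :
    (eulerStep J a T h ^ n) g ξ ∈ Set.Icc l u := by
  induction n generalizing ξ with
  | zero => simpa using hg ξ
  | succ n ih =>
    rw [pow_succ', Module.End.mul_apply]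
    exact eulerStep_mem_Icc ha h0 h1 ih ξ

/-- An average with fixed weights over monotone maps preserves monotonicity. This is the
attractiveness that allows one-step comparisons to be iterated. -/
theorem eulerStep_monotone [Preorder S] (ha : ∀ i ∈ J, 0 ≤ a i) (h0 : 0 ≤ h)
    (h1 : h * ∑ i ∈ J, a i ≤ 1) (hT : ∀ i, Monotone (T i)) {g : S → ℝ} (hg : Monotone g) :
    Monotone (eulerStep J a T h g) := by
  intro ξ ζ hξ
  simp only [eulerStep_apply]
  exact add_le_add (mul_le_mul_of_nonneg_left (hg hξ) (by linarith))
      (Finset.sum_le_sum fun i hi =>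
        mul_le_mul_of_nonneg_left (hg (hT i hξ)) (mul_nonneg h0 (ha i hi)))

/-- An Euler step of size `b * h` is a mixture of an idle step and an Euler step of size `h`. -/
theorem eulerStep_mul_pow (b : ℝ) (n : ℕ) :
    eulerStep J a T (b * h) ^ n =
      ∑ k ∈ Finset.range (n + 1),
        (b ^ k * (1 - b) ^ (n - k) * n.choose k) • eulerStep J a T h ^ k := by
  have key : eulerStep J a T (b * h) = b • eulerStep J a T h + (1 - b) • 1 := by
    simp only [eulerStep]
    module
  rw [key, Commute.add_pow]
  · refine Finset.sum_congr rfl fun k _ => ?_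
    rw [smul_pow, smul_pow, one_pow, ← nsmul_eq_mul', ← Nat.cast_smul_eq_nsmul ℝ, smul_mul_smul_comm,
      mul_one, smul_smul]
    congr 1
    ring
  · exact (Commute.one_right _).smul_right _

/-- The variance of one Euler step is at least a multiple of the squared increment along a single
jump. -/
theorem le_eulerStep_sq_sub (ha : ∀ i ∈ J, 0 ≤ a i) (h0 : 0 ≤ h) (h1 : h * ∑ i ∈ J, a i ≤ 1)
    (g : S → ℝ) (ξ : S) {i : ι} (hi : i ∈ J) :
    (1 - h * ∑ i ∈ J, a i) * (h * a i) * (g (T i ξ) - g ξ) ^ 2 ≤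
      eulerStep J a T h (fun ζ => g ζ ^ 2) ξ - eulerStep J a T h g ξ ^ 2 := by
  set m := eulerStep J a T h g ξ with hm
  set A := 1 - h * ∑ i ∈ J, a i with hA
  have hA0 : 0 ≤ A := by linarith
  have hsum : ∑ i ∈ J, h * a i = 1 - A := by rw [← Finset.mul_sum]; linarith
  have e1 : ∑ j ∈ J, h * a j * g (T j ξ) = m - A * g ξ := by
    rw [hm, eulerStep_apply]; ring
  have e2 : ∑ j ∈ J, h * a j * (g (T j ξ) - m) ^ 2 =
      ∑ j ∈ J, h * a j * g (T j ξ) ^ 2 - 2 * m * (m - A * g ξ) + (1 - A) * m ^ 2 := by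
    rw [← e1, ← hsum, Finset.mul_sum, Finset.sum_mul, ← Finset.sum_sub_distrib,
      ← Finset.sum_add_distrib]
    exact Finset.sum_congr rfl fun j _ => by ring
  have e3 : h * a i * (g (T i ξ) - m) ^ 2 ≤ ∑ j ∈ J, h * a j * (g (T j ξ) - m) ^ 2 :=
    Finset.single_le_sum (f := fun j => h * a j * (g (T j ξ) - m) ^ 2)
      (fun j hj => mul_nonneg (mul_nonneg h0 (ha j hj)) (sq_nonneg _)) hi
  have e4 : h * a i ≤ 1 - A := by
    rw [← hsum]
    exact Finset.single_le_sum (f := fun j => h * a j) (fun j hj => mul_nonneg h0 (ha j hj)) hi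
  have hb0 : 0 ≤ h * a i := mul_nonneg h0 (ha i hi)
  rw [eulerStep_apply, ← hA]
  generalize h * a i = b at *
  -- Of the variance only the idle term and the jump `i` are kept. The minimum over `m` of the
  -- right-hand side is `A * b / (A + b)` times the squared increment, and `A + b ≤ 1` by `e4`.
  have e5 : A * b * (g (T i ξ) - g ξ) ^ 2 ≤
      A * (g ξ - m) ^ 2 + b * (g (T i ξ) - m) ^ 2 := by
    nlinarith [sq_nonneg (A * (g ξ - m) + b * (g (T i ξ) - m)),
      mul_nonneg (mul_nonneg hA0 (sub_nonneg.2 e4)) (sq_nonneg (g ξ - m)),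
      mul_nonneg (mul_nonneg hb0 (sub_nonneg.2 e4)) (sq_nonneg (g (T i ξ) - m))]
  nlinarith

end Euler

/-! ### Ergodic theorem by decay of the `L²` energy -/

section Ergodic

variable {S ι : Type*} [Countable S] [MeasurableSpace S] [MeasurableSingletonClass S]
  {J : Finset ι} {a : ι → ℝ} {T : ι → S → S} {h : ℝ} {π : Measure S} [IsProbabilityMeasure π]

theorem integrable_of_mem_Icc {g : S → ℝ} {l u : ℝ} (hg : ∀ ξ, g ξ ∈ Set.Icc l u) :
    Integrable g π := 
  Integrable.of_mem_Icc l u (measurable_of_countable g).aemeasurable (ae_of_all _ hg)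

/-- If `π` is invariant, the increments of the iterates along every jump tend to `0`. -/
theorem tendsto_eulerStep_pow_sub (ha : ∀ i ∈ J, 0 < a i) (h0 : 0 < h)
    (h1 : h * ∑ i ∈ J, a i < 1)
    (hπ : ∀ (g : S → ℝ) (C : ℝ), (∀ ξ, g ξ ∈ Set.Icc (-C) C) →
      ∫ ξ, eulerStep J a T h g ξ ∂π = ∫ ξ, g ξ ∂π)
    {g : S → ℝ} {C : ℝ} (hg : ∀ ξ, g ξ ∈ Set.Icc (-C) C) {ξ : S} (hξ : π {ξ} ≠ 0)
    {i : ι} (hi : i ∈ J) :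
    Tendsto (fun n : ℕ => (eulerStep J a T h ^ n) g (T i ξ) - (eulerStep J a T h ^ n) g ξ)
      atTop (𝓝 0) := by
  have ha' : ∀ i ∈ J, 0 ≤ a i := fun i hi => (ha i hi).le
  set G : ℕ → S → ℝ := fun n => (eulerStep J a T h ^ n) g with hG
  have hGs : ∀ n, G (n + 1) = eulerStep J a T h (G n) := fun n => by
    simp only [hG, pow_succ', Module.End.mul_apply]
  have hGb : ∀ n ζ, G n ζ ∈ Set.Icc (-C) C := fun n ζ =>
    eulerStep_pow_mem_Icc ha' h0.le h1.le hg n ζ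
  have hsq : ∀ n ζ, G n ζ ^ 2 ∈ Set.Icc (-C ^ 2) (C ^ 2) := fun n ζ =>
    ⟨by nlinarith [sq_nonneg (G n ζ), sq_nonneg C], by
      have := hGb n ζ; rw [Set.mem_Icc] at this; nlinarith⟩
  have hint : ∀ n, Integrable (fun ζ => G n ζ ^ 2) π := fun n => integrable_of_mem_Icc (hsq n)
  set κ := (1 - h * ∑ i ∈ J, a i) * (h * a i) with hκ
  -- The strict inequality `h1` gives a positive probability of idling, which plays the role of
  -- aperiodicity.
  have hκ0 : 0 < κ := mul_pos (by linarith) (mul_pos h0 (ha i hi))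
  have hpi : 0 < π.real {ξ} := by
    rw [Measure.real, ENNReal.toReal_pos_iff]
    exact ⟨pos_iff_ne_zero.2 hξ, measure_lt_top _ _⟩
  set E : ℕ → ℝ := fun n => ∫ ζ, G n ζ ^ 2 ∂π with hE
  -- By invariance the integrated one-step variance is exactly the loss of energy. Restricting the
  -- integral to the atom `ξ` isolates a single increment; the losses tend to zero because the
  -- energy is nonnegative and decreasing.
  have hstep : ∀ n, κ * π.real {ξ} * (G n (T i ξ) - G n ξ) ^ 2 ≤ E n - E (n + 1) := by
    intro n
    have hi1 : Integrable (fun ζ => κ * (G n (T i ζ) - G n ζ) ^ 2) π :=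
      integrable_of_mem_Icc (l := 0) (u := κ * (2 * C) ^ 2) fun ζ => by
        have h1 := hGb n ζ
        have h2 := hGb n (T i ζ)
        rw [Set.mem_Icc] at h1 h2
        refine ⟨by positivity, mul_le_mul_of_nonneg_left ?_ hκ0.le⟩
        exact sq_le_sq' (by linarith) (by linarith)
    have hi2 : Integrable (eulerStep J a T h fun ζ => G n ζ ^ 2) π :=
      integrable_of_mem_Icc (eulerStep_mem_Icc ha' h0.le h1.le (hsq n))
    calc κ * π.real {ξ} * (G n (T i ξ) - G n ξ) ^ 2
        = ∫ ζ in {ξ}, κ * (G n (T i ζ) - G n ζ) ^ 2 ∂π := by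
          rw [integral_singleton, smul_eq_mul]; ring
      _ ≤ ∫ ζ, κ * (G n (T i ζ) - G n ζ) ^ 2 ∂π :=
          setIntegral_le_integral hi1 (ae_of_all _ fun ζ => by positivity)
      _ ≤ ∫ ζ, (eulerStep J a T h (fun ζ => G n ζ ^ 2) ζ - G (n + 1) ζ ^ 2) ∂π := by
          refine integral_mono hi1 (hi2.sub (hint (n + 1))) fun ζ => ?_
          rw [hGs]
          exact le_eulerStep_sq_sub ha' h0.le h1.le (G n) ζ hi
      _ = E n - E (n + 1) := by
          rw [integral_sub hi2 (hint _), hπ _ (C ^ 2) (by simpa using hsq n)]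
  have hanti : Antitone E := antitone_nat_of_succ_le fun n => by
    have := hstep n
    have h2 : 0 ≤ κ * π.real {ξ} * (G n (T i ξ) - G n ξ) ^ 2 := by positivity
    linarith
  have hbdd : BddBelow (Set.range E) := ⟨0, by
    rintro _ ⟨n, rfl⟩
    exact integral_nonneg fun ζ => sq_nonneg _⟩
  have hlim := tendsto_atTop_ciInf hanti hbdd
  have hdiff : Tendsto (fun n => E n - E (n + 1)) atTop (𝓝 0) := by
    simpa using hlim.sub (hlim.comp (tendsto_add_atTop_nat 1))
  have h3 : Tendsto (fun n => κ * π.real {ξ} * (G n (T i ξ) - G n ξ) ^ 2) atTop (𝓝 0) :=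
    squeeze_zero (fun n => by positivity) hstep hdiff
  have h4 : Tendsto (fun n => (G n (T i ξ) - G n ξ) ^ 2) atTop (𝓝 0) := by
    have := h3.const_mul (κ * π.real {ξ})⁻¹
    rw [mul_zero] at this
    refine this.congr fun n => ?_
    rw [← mul_assoc, inv_mul_cancel₀ (by positivity), one_mul]
  have h5 := h4.sqrt
  simp only [Real.sqrt_sq_eq_abs, Real.sqrt_zero] at h5
  exact (tendsto_zero_iff_abs_tendsto_zero _).2 h5

/-- Ergodic theorem: the iterates converge to the integral against the invariant measure, if all
states are connected by jumps. -/
theorem tendsto_eulerStep_pow (ha : ∀ i ∈ J, 0 < a i) (h0 : 0 < h) (h1 : h * ∑ i ∈ J, a i < 1)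
    (hπ : ∀ (g : S → ℝ) (C : ℝ), (∀ ξ, g ξ ∈ Set.Icc (-C) C) →
      ∫ ξ, eulerStep J a T h g ξ ∂π = ∫ ξ, g ξ ∂π)
    (hpos : ∀ ξ, π {ξ} ≠ 0)
    (hconn : ∀ r : S → S → Prop, Equivalence r → (∀ i ∈ J, ∀ ξ, r (T i ξ) ξ) → ∀ ξ ζ, r ξ ζ)
    {g : S → ℝ} {C : ℝ} (hg : ∀ ξ, g ξ ∈ Set.Icc (-C) C) (ξ : S) :
    Tendsto (fun n : ℕ => (eulerStep J a T h ^ n) g ξ) atTop (𝓝 (∫ ζ, g ζ ∂π)) := by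
  have ha' : ∀ i ∈ J, 0 ≤ a i := fun i hi => (ha i hi).le
  have hGb : ∀ n ζ, (eulerStep J a T h ^ n) g ζ ∈ Set.Icc (-C) C := fun n ζ =>
    eulerStep_pow_mem_Icc ha' h0.le h1.le hg n ζ
  have hall : ∀ ζ, Tendsto
      (fun n : ℕ => (eulerStep J a T h ^ n) g ζ - (eulerStep J a T h ^ n) g ξ) atTop (𝓝 0) := by
    intro ζ
    -- Asymptotic equality of the iterates at two states is an equivalence relation, and it contains
    -- every jump.
    refine hconn (fun ζ ζ' => Tendsto
      (fun n : ℕ => (eulerStep J a T h ^ n) g ζ - (eulerStep J a T h ^ n) g ζ') atTop (𝓝 0))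
      ⟨fun _ => by simp, fun h => by simpa using h.neg, fun h h' => by simpa using h.add h'⟩
      (fun i hi ζ => tendsto_eulerStep_pow_sub ha h0 h1 hπ hg (hpos ζ) hi) ζ ξ
  have hmass : ∀ n : ℕ, ∫ ζ, (eulerStep J a T h ^ n) g ζ ∂π = ∫ ζ, g ζ ∂π := by
    intro n
    induction n with
    | zero => simp
    | succ n ih =>
      rw [← ih, pow_succ']
      exact hπ _ C (hGb n)
  -- The `π`-mean of the iterates is conserved, so averaging the vanishing differences over `ζ`
  -- identifies the limit at `ξ`.
  have hdom : Tendsto (fun n : ℕ => ∫ ζ, ((eulerStep J a T h ^ n) g ζ -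
      (eulerStep J a T h ^ n) g ξ) ∂π) atTop (𝓝 (∫ _, (0 : ℝ) ∂π)) := by
    refine tendsto_integral_of_dominated_convergence (fun _ => 2 * C)
      (fun n => (measurable_of_countable _).aestronglyMeasurable) (integrable_const _)
      (fun n => ae_of_all _ fun ζ => ?_) (ae_of_all _ hall)
    have h1 := hGb n ζ
    have h2 := hGb n ξ
    rw [Set.mem_Icc] at h1 h2
    rw [Real.norm_eq_abs, abs_le]
    constructor <;> linarith
  have heq : ∀ n : ℕ, ∫ ζ, ((eulerStep J a T h ^ n) g ζ - (eulerStep J a T h ^ n) g ξ) ∂π =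
      ∫ ζ, g ζ ∂π - (eulerStep J a T h ^ n) g ξ := fun n => by
    rw [integral_sub (integrable_of_mem_Icc (hGb n)) (integrable_const _), hmass]
    simp
  simp only [heq, integral_zero] at hdom
  simpa using (tendsto_const_nhds (x := ∫ ζ, g ζ ∂π)).sub hdom

end Ergodic

/-! ### Binomial randomisation of the number of steps -/

/-- Binomial averages of a sequence that is eventually at most `l` are asymptotically at most `l`,
uniformly in the number of trials. -/
theorem eventually_binomial_average_le {u : ℕ → ℝ} {C l : ℝ} (hC : ∀ k, u k ≤ C)
    (hu : Tendsto u atTop (𝓝 l)) {ε : ℝ} (hε : 0 < ε) :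
    ∀ᶠ s : ℝ in atTop, ∀ n : ℕ, s ≤ n →
      ∑ k ∈ Finset.range (n + 1), (s / n) ^ k * (1 - s / n) ^ (n - k) * n.choose k * u k ≤
        l + ε := by
  obtain ⟨m, hm⟩ := eventually_atTop.1 (hu.eventually_le_const (show l < l + ε / 2 by linarith))
  set B := max (C - l) 0 with hB
  have hlim : Tendsto (fun s : ℝ => (m * B * Real.exp m) * (s ^ m * Real.exp (-s))) atTop
      (𝓝 0) := by
    simpa using (Real.tendsto_pow_mul_exp_neg_atTop_nhds_zero m).const_mul (m * B * Real.exp m)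
  filter_upwards [hlim.eventually_le_const (show 0 < ε / 2 by linarith), eventually_ge_atTop 1]
    with s hs hs1 n hn
  have hn0 : (0 : ℝ) < n := by linarith
  set b := s / n with hb
  have hb0 : 0 ≤ b := by positivity
  have hb1 : b ≤ 1 := (div_le_one hn0).2 hn
  have hnb : n * b = s := by rw [hb]; field_simp
  set w : ℕ → ℝ := fun k => b ^ k * (1 - b) ^ (n - k) * n.choose k with hw
  have hw0 : ∀ k, 0 ≤ w k := fun k => by
    have : 0 ≤ 1 - b := by linarith
    positivity
  have hw1 : ∑ k ∈ Finset.range (n + 1), w k = 1 := by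
    have := add_pow b (1 - b) n
    rw [← this]; simp
  -- The early weights vanish as `s → ∞` uniformly in `n`: `n.choose k ≤ n ^ k` is absorbed through
  -- `n * b = s`, and `(1 - b) ^ (n - k) ≤ exp (-b * (n - k)) ≤ exp (m - s)`.
  have hwk : ∀ k ∈ Finset.range (n + 1), k < m → w k ≤ Real.exp m * (s ^ m * Real.exp (-s)) := by
    intro k hk hkm
    have hkn : k ≤ n := Nat.lt_succ_iff.1 (Finset.mem_range.1 hk)
    have e1 : (n.choose k : ℝ) ≤ (n : ℝ) ^ k := by exact_mod_cast Nat.choose_le_pow n k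
    have e2 : (1 - b) ^ (n - k) ≤ Real.exp m * Real.exp (-s) := by
      calc (1 - b) ^ (n - k) ≤ Real.exp (-b) ^ (n - k) :=
            pow_le_pow_left₀ (by linarith) (by linarith [Real.add_one_le_exp (-b)]) _
        _ = Real.exp ((n - k : ℕ) * -b) := by rw [← Real.exp_nat_mul]
        _ ≤ Real.exp (m + -s) := by
            refine Real.exp_le_exp.2 ?_
            rw [Nat.cast_sub hkn]
            have : (k : ℝ) ≤ m := by exact_mod_cast hkm.le
            nlinarith
        _ = _ := Real.exp_add _ _
    calc w k = (1 - b) ^ (n - k) * (b ^ k * n.choose k) := by simp only [hw]; ring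
      _ ≤ (Real.exp m * Real.exp (-s)) * (b ^ k * (n : ℝ) ^ k) := by
          refine mul_le_mul e2 (mul_le_mul_of_nonneg_left e1 (by positivity)) (by positivity)
            (by positivity)
      _ = (Real.exp m * Real.exp (-s)) * s ^ k := by rw [← mul_pow, mul_comm b, hnb]
      _ ≤ (Real.exp m * Real.exp (-s)) * s ^ m := by
          gcongr
      _ = _ := by ring
  have hterm : ∀ k ∈ Finset.range (n + 1), w k * u k ≤
      w k * (l + ε / 2) + if k < m then B * (Real.exp m * (s ^ m * Real.exp (-s))) else 0 := by
    intro k hk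
    split_ifs with hkm
    · have h1 : u k ≤ l + B := by
        have := hC k; have := le_max_left (C - l) 0; linarith
      calc w k * u k ≤ w k * (l + B) := mul_le_mul_of_nonneg_left h1 (hw0 k)
        _ = w k * l + B * w k := by ring
        _ ≤ w k * (l + ε / 2) + B * (Real.exp m * (s ^ m * Real.exp (-s))) :=
            add_le_add (mul_le_mul_of_nonneg_left (by linarith) (hw0 k))
              (mul_le_mul_of_nonneg_left (hwk k hk hkm) (le_max_right _ _))
    · rw [add_zero]
      exact mul_le_mul_of_nonneg_left (hm k (not_lt.1 hkm)) (hw0 k)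
  calc ∑ k ∈ Finset.range (n + 1), w k * u k
      ≤ ∑ k ∈ Finset.range (n + 1), (w k * (l + ε / 2) +
          if k < m then B * (Real.exp m * (s ^ m * Real.exp (-s))) else 0) :=
        Finset.sum_le_sum hterm
    _ ≤ (l + ε / 2) + m * (B * (Real.exp m * (s ^ m * Real.exp (-s)))) := by
        rw [Finset.sum_add_distrib, ← Finset.sum_mul, hw1, one_mul, ← Finset.sum_filter,
          Finset.sum_const, nsmul_eq_mul]
        refine add_le_add le_rfl (mul_le_mul_of_nonneg_right ?_ ?_)
        · calc (_ : ℝ) ≤ (Finset.range m).card :=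
                Nat.cast_le.2 (Finset.card_le_card fun k hk => by
                  simpa using (Finset.mem_filter.1 hk).2)
            _ = m := by rw [Finset.card_range]
        · have : 0 ≤ B := le_max_right _ _
          have : 0 ≤ s := by linarith
          positivity
    _ ≤ l + ε := by linarith [hs]

/-! ### Geometric laws -/

/-- The geometric law on `ℕ` with parameter `r`. -/
noncomputable def geometricLaw (r : ℝ) : Measure ℕ :=
  Measure.sum fun k : ℕ => ENNReal.ofReal (r ^ k * (1 - r)) • (Measure.dirac k : Measure ℕ)

theorem geometricLaw_singleton (r : ℝ) (k : ℕ) :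
    geometricLaw r {k} = ENNReal.ofReal (r ^ k * (1 - r)) := by
  rw [geometricLaw, Measure.sum_apply _ (measurableSet_singleton k), tsum_eq_single k]
  · simp
  · intro j hj
    simp [hj]

theorem isProbabilityMeasure_geometricLaw {r : ℝ} (h0 : 0 ≤ r) (h1 : r < 1) :
    IsProbabilityMeasure (geometricLaw r) := by
  constructor
  rw [geometricLaw, Measure.sum_apply _ MeasurableSet.univ]
  have h2 : ∀ k : ℕ, 0 ≤ r ^ k * (1 - r) := fun k =>
    mul_nonneg (pow_nonneg h0 k) (by linarith)
  simp only [Measure.smul_apply, measure_univ, smul_eq_mul, mul_one]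
  rw [← ENNReal.ofReal_tsum_of_nonneg h2 ((summable_geometric_of_lt_one h0 h1).mul_right _),
    tsum_mul_right, tsum_geometric_of_lt_one h0 h1, inv_mul_cancel₀ (by linarith),
    ENNReal.ofReal_one]

theorem pi_geometricLaw_real_singleton {ι : Type*} [Fintype ι] {r : ι → ℝ} (h0 : ∀ i, 0 ≤ r i)
    (h1 : ∀ i, r i < 1) (ξ : ι → ℕ) :
    (Measure.pi fun i => geometricLaw (r i)).real {ξ} = ∏ i, (r i ^ ξ i * (1 - r i)) := by
  have := fun i => isProbabilityMeasure_geometricLaw (h0 i) (h1 i)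
  rw [Measure.real, Measure.pi_singleton, ENNReal.toReal_prod]
  refine Finset.prod_congr rfl fun i _ => ?_
  rw [geometricLaw_singleton, ENNReal.toReal_ofReal]
  exact mul_nonneg (pow_nonneg (h0 i) _) (by linarith [h1 i])

/-! ### The tandem of queues: monotonicity, invariance, irreducibility -/

section Tandem

open scoped Classical

variable {W : Finset ℤ}

/-- One particle at `z`, seen in the window `W`: this is `0` if `z ∉ W`. -/
def unitAt (W : Finset ℤ) (z : ℤ) : W → ℕ := fun y => if (y : ℤ) = z then 1 else 0

/-- The jump of a particle from `z` to `z + 1`, seen in the window `W`. Sites outside `W` act as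
inexhaustible sources and as sinks. -/
noncomputable def hop (W : Finset ℤ) (z : ℤ) (ξ : W → ℕ) : W → ℕ := fun y =>
  ξ y - unitAt W z y + if unitAt W z ≤ ξ then unitAt W (z + 1) y else 0

theorem unitAt_of_notMem {z : ℤ} (hz : z ∉ W) : unitAt W z = 0 := by
  ext y
  have : (y : ℤ) ≠ z := fun h => hz (h ▸ y.2)
  simp [unitAt, this]

theorem unitAt_le_iff {z : ℤ} (hz : z ∈ W) (ξ : W → ℕ) : unitAt W z ≤ ξ ↔ 0 < ξ ⟨z, hz⟩ := by
  constructor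
  · intro h
    have h1 : unitAt W z ⟨z, hz⟩ ≤ ξ ⟨z, hz⟩ := h _
    have h2 : unitAt W z ⟨z, hz⟩ = 1 := by simp [unitAt]
    omega
  · intro h y
    unfold unitAt
    split_ifs with hy
    · have : y = ⟨z, hz⟩ := Subtype.ext hy
      rw [this]; exact h
    · exact Nat.zero_le _

theorem hop_of_le {z : ℤ} {ξ : W → ℕ} (h : unitAt W z ≤ ξ) :
    hop W z ξ = ξ - unitAt W z + unitAt W (z + 1) := by
  ext y; simp [hop, h]

theorem hop_of_not_le {z : ℤ} {ξ : W → ℕ} (h : ¬ unitAt W z ≤ ξ) : hop W z ξ = ξ := by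
  have hz : z ∈ W := by
    by_contra hz
    exact h (by rw [unitAt_of_notMem hz]; exact fun _ => Nat.zero_le _)
  rw [unitAt_le_iff hz, not_lt, Nat.le_zero] at h
  ext y
  have h2 : ¬ unitAt W z ≤ ξ := by rw [unitAt_le_iff hz]; omega
  simp only [hop, h2, if_false, add_zero, unitAt]
  split_ifs with hy
  · have : y = ⟨z, hz⟩ := Subtype.ext hy
    rw [this, h]
  · rfl

/-- A hop possible from the smaller configuration is possible from the larger one. Truncated
subtraction gives the departure site the same monotone formula whether it is occupied or empty. -/
theorem hop_monotone (z : ℤ) : Monotone (hop W z) := by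
  intro ξ ζ h y
  simp only [hop]
  have h1 : (if unitAt W z ≤ ξ then unitAt W (z + 1) y else 0) ≤
      if unitAt W z ≤ ζ then unitAt W (z + 1) y else 0 := by
    by_cases hξ : unitAt W z ≤ ξ
    · rw [if_pos hξ, if_pos (hξ.trans h)]
    · rw [if_neg hξ]; exact Nat.zero_le _
  exact add_le_add (Nat.sub_le_sub_right (h y) _) h1

variable {r : ℤ → ℝ}

/-- Geometric weights are multiplicative in the particle number. A site outside the window carries
no coordinate, whence the factor one; this is what lets the source be treated like the other sites.
-/
theorem pi_geometricLaw_real_singleton_add (h0 : ∀ z ∈ W, 0 ≤ r z) (h1 : ∀ z ∈ W, r z < 1)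
    (z : ℤ) (ξ : W → ℕ) :
    (Measure.pi fun y : W => geometricLaw (r y)).real {ξ + unitAt W z} =
      (if z ∈ W then r z else 1) * (Measure.pi fun y : W => geometricLaw (r y)).real {ξ} := by
  have h3 := pi_geometricLaw_real_singleton (r := fun y : W => r y) (fun y => h0 y y.2)
    (fun y => h1 y y.2)
  rw [h3, h3]
  have h2 : ∏ y : W, r y ^ unitAt W z y = if z ∈ W then r z else 1 := by
    split_ifs with hz
    · rw [Finset.prod_eq_single (⟨z, hz⟩ : W)]
      · simp [unitAt]
      · intro y _ hy
        have : (y : ℤ) ≠ z := fun h => hy (Subtype.ext h)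
        simp [unitAt, this]
      · simp
    · rw [unitAt_of_notMem hz]; simp
  rw [← h2, ← Finset.prod_mul_distrib]
  refine Finset.prod_congr rfl fun y _ => ?_
  rw [Pi.add_apply, pow_add]
  ring

/-- Adding a particle at `z` to a product geometric configuration. -/
theorem integral_pi_geometricLaw_indicator (h0 : ∀ z ∈ W, 0 ≤ r z) (h1 : ∀ z ∈ W, r z < 1)
    (z : ℤ) {G : (W → ℕ) → ℝ} {C : ℝ} (hG : ∀ ξ, G ξ ∈ Set.Icc (-C) C) :
    ∫ ξ, (if unitAt W z ≤ ξ then G ξ else 0) ∂(Measure.pi fun y : W => geometricLaw (r y)) =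
      (if z ∈ W then r z else 1) *
        ∫ ξ, G (ξ + unitAt W z) ∂(Measure.pi fun y : W => geometricLaw (r y)) := by
  have := fun y : W => isProbabilityMeasure_geometricLaw (h0 y y.2) (h1 y y.2)
  have hC : 0 ≤ C := by
    have := hG 0
    rw [Set.mem_Icc] at this
    linarith
  rw [integral_countable, integral_countable, ← tsum_mul_left]
  rotate_left
  · exact integrable_of_mem_Icc fun ξ => hG _
  · refine integrable_of_mem_Icc (l := -C) (u := C) fun ξ => ?_
    split_ifs
    · exact hG ξ
    · exact ⟨by linarith, hC⟩
  have hinj : Function.Injective fun ξ : W → ℕ => ξ + unitAt W z := add_left_injective _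
  -- The sum is reindexed by removing the particle: configurations occupied at `z` are exactly the
  -- range of adding one there.
  rw [← hinj.tsum_eq]
  · refine tsum_congr fun ξ => ?_
    have : unitAt W z ≤ ξ + unitAt W z := fun y => Nat.le_add_left _ _
    simp only [this, if_true]
    rw [pi_geometricLaw_real_singleton_add h0 h1, smul_eq_mul, smul_eq_mul, mul_assoc]
  · intro ξ hξ
    by_cases h : unitAt W z ≤ ξ
    · exact ⟨ξ - unitAt W z, by ext y; simpa using Nat.sub_add_cancel (h y)⟩
    · simp [h] at hξ

theorem sum_Icc_int_sub {x K : ℤ} (hxK : x ≤ K) (F : ℤ → ℝ) :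
    ∑ z ∈ Finset.Icc x K, (F (z + 1) - F z) = F (K + 1) - F x := by
  induction K, hxK using Int.leInduction with
  | base => simp
  | succ K hK ih =>
    have : Finset.Icc x (K + 1) = insert (K + 1) (Finset.Icc x K) := by
      ext z; simp only [Finset.mem_Icc, Finset.mem_insert]; omega
    rw [this, Finset.sum_insert (by simp), ih]
    ring

/-- The generator of the tandem of queues at the sites `x + 1, …, K`, fed at rate `p x`. -/
noncomputable abbrev tandemStep (p : ℤ → ℝ) (x K : ℤ) (h : ℝ) :
    Module.End ℝ ((Finset.Ioc x K → ℕ) → ℝ) :=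
  eulerStep (Finset.Icc x K) p (hop (Finset.Ioc x K)) h

/-- The stationary law of the tandem of queues at the sites `x + 1, …, K`. -/
noncomputable abbrev tandemLaw (p : ℤ → ℝ) (x K : ℤ) : Measure (Finset.Ioc x K → ℕ) :=
  Measure.pi fun y : Finset.Ioc x K => geometricLaw (p x / p y)

variable {p : ℤ → ℝ} {x K : ℤ}

theorem isProbabilityMeasure_tandemLaw (hp : ∀ z, 0 < p z)
    (hlt : ∀ z ∈ Finset.Ioc x K, p x < p z) : IsProbabilityMeasure (tandemLaw p x K) := by
  have := fun y : Finset.Ioc x K => isProbabilityMeasure_geometricLaw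
    (div_nonneg (hp x).le (hp y).le) ((div_lt_one (hp y)).2 (hlt y y.2))
  infer_instance

/-- The stationary flux out of `z` is `p z * (p x / p z) = p x` at every site of the window, and is
`p x` at the source. The integrated generator therefore telescopes to `p x * (F (K + 1) - F x)`,
which vanishes because a particle at `x` or at `K + 1` is invisible in the window. -/
theorem integral_tandemStep (hp : ∀ z, 0 < p z) (hxK : x ≤ K)
    (hlt : ∀ z ∈ Finset.Ioc x K, p x < p z) (h : ℝ) {g : (Finset.Ioc x K → ℕ) → ℝ} {C : ℝ}
    (hg : ∀ ξ, g ξ ∈ Set.Icc (-C) C) :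
    ∫ ξ, tandemStep p x K h g ξ ∂(tandemLaw p x K) = ∫ ξ, g ξ ∂(tandemLaw p x K) := by
  have := isProbabilityMeasure_tandemLaw hp hlt
  let F : ℤ → ℝ := fun z => ∫ ξ, g (ξ + unitAt (Finset.Ioc x K) z) ∂(tandemLaw p x K)
  have hgi : ∀ φ : ((Finset.Ioc x K) → ℕ) → ((Finset.Ioc x K) → ℕ), Integrable (fun ξ => g (φ ξ)) (tandemLaw p x K) :=
    fun φ => integrable_of_mem_Icc fun ξ => hg (φ ξ)
  have hflux : ∀ z ∈ Finset.Icc x K, ∫ ξ, p z * (g (hop (Finset.Ioc x K) z ξ) - g ξ) ∂(tandemLaw p x K) =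
      p x * (F (z + 1) - F z) := by
    intro z hz
    have e1 : ∀ ξ, g (hop (Finset.Ioc x K) z ξ) - g ξ = if unitAt (Finset.Ioc x K) z ≤ ξ then
        g (ξ - unitAt (Finset.Ioc x K) z + unitAt (Finset.Ioc x K) (z + 1)) - g ξ else 0 := by
      intro ξ
      split_ifs with hξ
      · rw [hop_of_le hξ]
      · rw [hop_of_not_le hξ, sub_self]
    simp only [e1]
    rw [integral_const_mul]
    refine (congrArg (p z * ·) (integral_pi_geometricLaw_indicator (r := fun y => p x / p y)
      (C := 2 * C) (fun z _ => div_nonneg (hp x).le (hp z).le)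
      (fun z hz => (div_lt_one (hp z)).2 (hlt z hz)) z ?_)).trans ?_
    rotate_left
    · rw [← mul_assoc]
      congr 1
      · split_ifs with hzW
        · field_simp [(hp z).ne']
        · have : z = x := by
            rw [Finset.mem_Ioc] at hzW; rw [Finset.mem_Icc] at hz; omega
          rw [this, mul_one]
      · rw [← integral_sub (hgi _) (hgi _)]
        refine integral_congr_ae (ae_of_all _ fun ξ => ?_)
        simp only
        congr 3
        ext y
        simp
    · intro ξ
      have h1 := hg (ξ - unitAt (Finset.Ioc x K) z + unitAt (Finset.Ioc x K) (z + 1))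
      have h2 := hg ξ
      rw [Set.mem_Icc] at h1 h2 ⊢
      constructor <;> linarith
  have e2 : ∀ ξ, tandemStep p x K h g ξ =
      g ξ + h * ∑ z ∈ Finset.Icc x K, p z * (g (hop (Finset.Ioc x K) z ξ) - g ξ) := by
    intro ξ
    simp [tandemStep, eulerStep, jumpGenerator_apply]
  have hi : ∀ z ∈ Finset.Icc x K,
      Integrable (fun ξ => p z * (g (hop (Finset.Ioc x K) z ξ) - g ξ)) (tandemLaw p x K) := fun z _ =>
    ((hgi _).sub (hgi _)).const_mul _
  simp only [e2]
  rw [integral_add (hgi _) ((integrable_finsetSum _ hi).const_mul _), integral_const_mul,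
    integral_finsetSum _ hi, Finset.sum_congr rfl hflux, ← Finset.mul_sum, sum_Icc_int_sub hxK]
  have h3 : F (K + 1) = F x := by
    simp only [F]
    rw [unitAt_of_notMem (by simp), unitAt_of_notMem (by simp)]
  rw [h3]
  simp

/-- An extra particle can be hopped to the right until it leaves beyond `K`, so a configuration is
related to itself with that particle removed. Removing particles one by one relates everything to
the empty configuration. -/
theorem tandem_connected {R : (Finset.Ioc x K → ℕ) → (Finset.Ioc x K → ℕ) → Prop}
    (hR : Equivalence R)
    (hhop : ∀ z ∈ Finset.Icc x K, ∀ ξ, R (hop (Finset.Ioc x K) z ξ) ξ) (ξ ζ) : R ξ ζ := by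
  have hadd : ∀ (m : ℕ) (z : ℤ), x < z → K + 1 - z = m → ∀ ξ, R (ξ + unitAt (Finset.Ioc x K) z) ξ := by
    intro m
    induction m with
    | zero =>
      intro z _ hm ξ
      rw [unitAt_of_notMem (by simp; omega), add_zero]
      exact hR.refl _
    | succ m ih =>
      intro z hz hm ξ
      have h1 := hhop z (by rw [Finset.mem_Icc]; push_cast at hm; omega) (ξ + unitAt (Finset.Ioc x K) z)
      have hle : unitAt (Finset.Ioc x K) z ≤ ξ + unitAt (Finset.Ioc x K) z :=
        fun y => Nat.le_add_left _ _
      rw [hop_of_le hle] at h1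
      have h2 : ξ + unitAt (Finset.Ioc x K) z - unitAt (Finset.Ioc x K) z + unitAt (Finset.Ioc x K) (z + 1) = ξ + unitAt (Finset.Ioc x K) (z + 1) := by
        ext y; simp
      rw [h2] at h1
      exact hR.trans (hR.symm h1) (ih (z + 1) (by omega) (by push_cast at hm; omega) ξ)
  have hzero : ∀ (m : ℕ) (ξ : (Finset.Ioc x K) → ℕ), ∑ y, ξ y = m → R ξ 0 := by
    intro m
    induction m with
    | zero =>
      intro ξ hξ
      have : ξ = 0 := by
        ext y
        exact (Finset.sum_eq_zero_iff.1 hξ) y (Finset.mem_univ _)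
      rw [this]
      exact hR.refl _
    | succ m ih =>
      intro ξ hξ
      obtain ⟨y, -, hy⟩ := Finset.exists_ne_zero_of_sum_ne_zero (show ∑ y, ξ y ≠ 0 by omega)
      have hle : unitAt (Finset.Ioc x K) y ≤ ξ := (unitAt_le_iff y.2 ξ).2 (Nat.pos_of_ne_zero hy)
      have hy2 := Finset.mem_Ioc.1 y.2
      have h1 : ξ - unitAt (Finset.Ioc x K) y + unitAt (Finset.Ioc x K) y = ξ := by
        ext w; simpa using Nat.sub_add_cancel (hle w)
      have h2 : ∑ w, unitAt (Finset.Ioc x K) y w = 1 := by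
        simp only [unitAt, Subtype.coe_inj]
        simp
      have h3 : ∑ w, (ξ - unitAt (Finset.Ioc x K) y) w = m := by
        have : ∑ w, (ξ - unitAt (Finset.Ioc x K) y + unitAt (Finset.Ioc x K) y) w = m + 1 := by rw [h1, hξ]
        simp only [Pi.add_apply, Finset.sum_add_distrib, h2] at this
        omega
      have h4 := hadd (K + 1 - y).toNat y hy2.1 (by omega) (ξ - unitAt (Finset.Ioc x K) y)
      rw [h1] at h4
      exact hR.trans h4 (ih _ h3)
  exact hR.trans (hzero _ ξ rfl) (hR.symm (hzero _ ζ rfl))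

theorem tandemLaw_singleton_ne_zero (hp : ∀ z, 0 < p z)
    (hlt : ∀ z ∈ Finset.Ioc x K, p x < p z) (ξ) : tandemLaw p x K {ξ} ≠ 0 := by
  have := fun y : Finset.Ioc x K => isProbabilityMeasure_geometricLaw
    (div_nonneg (hp x).le (hp y).le) ((div_lt_one (hp y)).2 (hlt y y.2))
  rw [Measure.pi_singleton, Finset.prod_ne_zero_iff]
  intro y _
  rw [geometricLaw_singleton]
  have h1 := (div_lt_one (hp y)).2 (hlt y y.2)
  have h2 := div_pos (hp x) (hp y)
  exact (ENNReal.ofReal_pos.2 (mul_pos (pow_pos h2 _) (by linarith))).ne'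

/-- The tandem of queues converges to its stationary law. -/
theorem tendsto_tandemStep_pow (hp : ∀ z, 0 < p z) (hxK : x ≤ K)
    (hlt : ∀ z ∈ Finset.Ioc x K, p x < p z) {h : ℝ} (h0 : 0 < h)
    (h1 : h * ∑ z ∈ Finset.Icc x K, p z < 1) {g : (Finset.Ioc x K → ℕ) → ℝ} {C : ℝ}
    (hg : ∀ ξ, g ξ ∈ Set.Icc (-C) C) (ξ) :
    Tendsto (fun n : ℕ => (tandemStep p x K h ^ n) g ξ) atTop
      (𝓝 (∫ ζ, g ζ ∂(tandemLaw p x K))) := by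
  have := isProbabilityMeasure_tandemLaw hp hlt
  exact tendsto_eulerStep_pow (fun z _ => hp z) h0 h1
    (fun g C hg => integral_tandemStep hp hxK hlt h hg) (tandemLaw_singleton_ne_zero hp hlt)
    (fun R hR hhop => tandem_connected hR hhop) hg ξ

end Tandem

/-! ### Deterministic analysis of the paths -/

section Paths

theorem JumpsAt.lt {n : ℝ≥0 → ℕ} (hn : Monotone n) {s t : ℝ≥0} (hst : s < t)
    (ht : JumpsAt n t) : n s < n t := by
  refine lt_of_le_of_ne (hn hst.le) fun heq => ht ?_
  filter_upwards [Ioo_mem_nhdsLT hst] with r hr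
  exact le_antisymm (hn hr.2.le) (heq ▸ hn hr.1.le)

/-- The value of the clock is injective on its jump times and bounded by its value at `t`.
Finiteness matters because `Set.ncard` is zero on infinite sets. -/
theorem finite_departures {n : ℝ≥0 → ℕ} (hn : Monotone n) (e : ℝ≥0 → ℕ) (t : ℝ≥0) :
    {s : ℝ≥0 | 0 < s ∧ s ≤ t ∧ JumpsAt n s ∧ ∀ᶠ r in 𝓝[<] s, 0 < e r}.Finite := by
  refine Set.Finite.of_injOn (f := n) (t := Set.Iic (n t)) (fun s hs => hn hs.2.1) ?_
    (Set.finite_Iic _)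
  intro s hs s' hs' heq
  rcases lt_trichotomy s s' with h | h | h
  · exact absurd heq (hs'.2.2.1.lt hn h).ne
  · exact h
  · exact absurd heq (hs.2.2.1.lt hn h).ne'

/-- No particle leaves while the clock does not ring. -/
theorem departures_eq {n : ℝ≥0 → ℕ} (hn : Monotone n) (e : ℝ≥0 → ℕ) {s t : ℝ≥0} (hst : s ≤ t)
    (h : n t = n s) : departures n e t = departures n e s := by
  unfold departures
  congr 1
  ext r
  refine ⟨fun hr => ⟨hr.1, ?_, hr.2.2⟩, fun hr => ⟨hr.1, hr.2.1.trans hst, hr.2.2⟩⟩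
  by_contra hlt
  have h1 := hr.2.2.1.lt hn (not_le.1 hlt)
  have h2 := hn hr.2.1
  omega

open scoped Classical in
/-- If the clock rings once, at most one particle leaves, and it does so if and only if the site is
occupied at that time. -/
theorem exists_departures_eq {n : ℝ≥0 → ℕ} (hn : Monotone n)
    (hc : ∀ t, ContinuousWithinAt n (Set.Ici t) t) (e : ℝ≥0 → ℕ) {s t : ℝ≥0} (hst : s ≤ t)
    (h : n t = n s + 1) :
    ∃ σ, s < σ ∧ σ ≤ t ∧ (∀ r, s ≤ r → r < σ → n r = n s) ∧
      departures n e t =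
        departures n e s + if ∀ᶠ r in 𝓝[<] σ, 0 < e r then 1 else 0 := by
  -- The ringing time is the infimum of the times at which the clock has advanced; right-continuity
  -- shows that the infimum is attained.
  set A := {r : ℝ≥0 | n s + 1 ≤ n r} with hA
  have htA : t ∈ A := h.ge
  set σ := sInf A with hσ
  have hσt : σ ≤ t := csInf_le (OrderBot.bddBelow _) htA
  have hσA : n s + 1 ≤ n σ := by
    have h1 := hc σ
    rw [ContinuousWithinAt, nhds_discrete, tendsto_pure, eventually_nhdsWithin_iff,
      Metric.eventually_nhds_iff] at h1
    obtain ⟨ε, hε, h1⟩ := h1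
    obtain ⟨r, hr, hrσ⟩ := exists_lt_of_csInf_lt ⟨t, htA⟩
      (show sInf A < σ + ⟨ε, hε.le⟩ from lt_add_of_pos_right _ hε)
    have hσr : σ ≤ r := csInf_le (OrderBot.bddBelow _) hr
    have h2 := h1 (y := r) (by
      have h3 : (r : ℝ) < σ + ε := by exact_mod_cast hrσ
      have h4 : (σ : ℝ) ≤ r := by exact_mod_cast hσr
      rw [NNReal.dist_eq, abs_of_nonneg (by linarith)]
      linarith) hσr
    rw [← h2]
    exact hr
  have hsσ : s < σ := by
    by_contra hle
    have := hn (not_lt.1 hle)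
    omega
  have hbefore : ∀ r, s ≤ r → r < σ → n r = n s := by
    intro r hsr hrσ
    have h1 : ¬ (n s + 1 ≤ n r) := fun hr =>
      absurd (csInf_le (OrderBot.bddBelow A) (show r ∈ A from hr)) (not_le.2 hrσ)
    have h2 := hn hsr
    omega
  have hjump : JumpsAt n σ := by
    intro hev
    have := nhdsLT_neBot_of_exists_lt ⟨s, hsσ⟩
    obtain ⟨r, hr1, hr2⟩ := (hev.and (Ioo_mem_nhdsLT hsσ)).exists
    have := hbefore r hr2.1.le hr2.2
    omega
  have huniq : ∀ r, s < r → r ≤ t → JumpsAt n r → r = σ := by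
    intro r hsr hrt hr
    have h0 := hr.lt hn hsr
    rcases lt_trichotomy r σ with h1 | h1 | h1
    · have := hbefore r hsr.le h1
      omega
    · exact h1
    · have h2 := hr.lt hn h1
      have h3 := hn hrt
      omega
  refine ⟨σ, hsσ, hσt, hbefore, ?_⟩
  unfold departures
  split_ifs with hocc
  · rw [← Set.ncard_insert_of_notMem (a := σ) (fun hmem => absurd hmem.2.1 (not_le.2 hsσ))
      (finite_departures hn e s)]
    congr 1
    ext r
    constructor
    · rintro ⟨h1, h2, h3, h4⟩
      rcases le_or_gt r s with hrs | hrs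
      · exact Or.inr ⟨h1, hrs, h3, h4⟩
      · exact Or.inl (huniq r hrs h2 h3)
    · rintro (rfl | ⟨h1, h2, h3, h4⟩)
      · exact ⟨bot_le.trans_lt hsσ, hσt, hjump, hocc⟩
      · exact ⟨h1, h2.trans hst, h3, h4⟩
  · rw [add_zero]
    congr 1
    ext r
    constructor
    · rintro ⟨h1, h2, h3, h4⟩
      rcases le_or_gt r s with hrs | hrs
      · exact ⟨h1, hrs, h3, h4⟩
      · rw [huniq r hrs h2 h3] at h4
        exact absurd h4 hocc
    · rintro ⟨h1, h2, h3, h4⟩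
      exact ⟨h1, h2.trans hst, h3, h4⟩

variable {n : ℤ → ℝ≥0 → ℕ} {e : ℝ≥0 → Config} {x K : ℤ} {s t : ℝ≥0}

/-- The content of `y` changes only through the clocks at `y - 1` and `y`; this is why the window
`(x, K]` goes with the clocks of `[x, K]`. -/
theorem restrict_eq_of_no_jump (hn : ∀ z, Monotone (n z))
    (hev : ∀ (t : ℝ≥0) (z : ℤ), e t z + departures (n z) (e · z) t =
      e 0 z + departures (n (z - 1)) (e · (z - 1)) t)
    (hst : s ≤ t) (h : ∀ z ∈ Finset.Icc x K, n z t = n z s) (y : ℤ) (hy : y ∈ Finset.Ioc x K) :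
    e t y = e s y := by
  rw [Finset.mem_Ioc] at hy
  have h1 := departures_eq (hn y) (e · y) hst (h y (by rw [Finset.mem_Icc]; omega))
  have h2 := departures_eq (hn (y - 1)) (e · (y - 1)) hst
    (h (y - 1) (by rw [Finset.mem_Icc]; omega))
  have h3 := hev t y
  have h4 := hev s y
  omega

/-- If exactly one clock of the window rings, and it rings once, then the new configuration is at
most the result of the corresponding hop. -/
theorem restrict_le_hop_of_single_jump (hn : ∀ z, Monotone (n z))
    (hc : ∀ z t, ContinuousWithinAt (n z) (Set.Ici t) t)
    (hev : ∀ (t : ℝ≥0) (z : ℤ), e t z + departures (n z) (e · z) t =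
      e 0 z + departures (n (z - 1)) (e · (z - 1)) t)
    (hst : s ≤ t) {w : ℤ} (hw : n w t = n w s + 1)
    (h : ∀ z ∈ Finset.Icc x K, z ≠ w → n z t = n z s) :
    (Finset.Ioc x K).restrict (e t) ≤
      hop (Finset.Ioc x K) w ((Finset.Ioc x K).restrict (e s)) := by
  classical
  obtain ⟨σ, hsσ, hσt, hbefore, hdep⟩ := exists_departures_eq (hn w) (hc w) (e · w) hst hw
  -- Between `s` and `σ` no clock relevant to the window rings, so occupation just before the ring
  -- can be read off at time `s`.
  have hocc : w ∈ Finset.Ioc x K → ((∀ᶠ r in 𝓝[<] σ, 0 < e r w) ↔ 0 < e s w) := by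
    intro hwW
    have hconst : ∀ r, s ≤ r → r < σ → e r w = e s w := by
      intro r hsr hrσ
      refine restrict_eq_of_no_jump (x := x) (K := K) hn hev hsr (fun z hz => ?_) w hwW
      by_cases hzw : z = w
      · rw [hzw]; exact hbefore r hsr hrσ
      · exact le_antisymm ((hn z (hrσ.le.trans hσt)).trans (h z hz hzw).le) (hn z hsr)
    constructor
    · intro hev'
      have := nhdsLT_neBot_of_exists_lt ⟨s, hsσ⟩
      obtain ⟨r, hr1, hr2⟩ := (hev'.and (Ioo_mem_nhdsLT hsσ)).exists
      rwa [hconst r hr2.1.le hr2.2] at hr1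
    · intro hpos
      filter_upwards [Ioo_mem_nhdsLT hsσ] with r hr
      rwa [hconst r hr.1.le hr.2]
  have hother : ∀ z ∈ Finset.Icc x K, z ≠ w →
      departures (n z) (e · z) t = departures (n z) (e · z) s := fun z hz hzw =>
    departures_eq (hn z) _ hst (h z hz hzw)
  intro y
  have hy := Finset.mem_Ioc.1 y.2
  have h3 := hev t y
  have h4 := hev s y
  have hle : unitAt (Finset.Ioc x K) w ≤ (Finset.Ioc x K).restrict (e s) ↔
      (w ∈ Finset.Ioc x K → 0 < e s w) := by
    by_cases hwW : w ∈ Finset.Ioc x K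
    · rw [unitAt_le_iff hwW]
      simp [hwW]
    · rw [unitAt_of_notMem hwW]
      simp only [hwW, false_imp_iff, iff_true]
      exact fun _ => Nat.zero_le _
  simp only [hop, hle, unitAt, Finset.restrict]
  by_cases hyw : (y : ℤ) = w
  · have hwW : w ∈ Finset.Ioc x K := hyw ▸ y.2
    have h5 := hother (y - 1) (by rw [Finset.mem_Icc]; omega) (by omega)
    rw [h5] at h3
    rw [hyw] at h3 h4 ⊢
    rw [hdep] at h3
    simp only [hocc hwW] at h3
    simp only [if_true]
    split_ifs at h3 ⊢ <;> omega
  · have h5 := hother y (by rw [Finset.mem_Icc]; omega) hyw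
    rw [h5] at h3
    simp only [hyw, if_false]
    by_cases hyw' : (y : ℤ) - 1 = w
    · have hyw2 : (y : ℤ) = w + 1 := by omega
      rw [hyw'] at h3 h4
      rw [hdep] at h3
      simp only [hyw2, if_true]
      rw [hyw2] at h3 h4
      by_cases hwW : w ∈ Finset.Ioc x K
      · simp only [hocc hwW] at h3
        simp only [hwW, true_imp_iff]
        split_ifs at h3 ⊢ <;> omega
      -- Here `w = x`: the hop always injects a particle, whereas the process does so only if `x` is
      -- occupied. This is the only case where equality can fail.
      · simp only [hwW, false_imp_iff, if_true]
        split_ifs at h3 <;> omega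
    · have h6 := hother (y - 1) (by rw [Finset.mem_Icc]; omega) hyw'
      have hyw2 : (y : ℤ) ≠ w + 1 := by omega
      simp only [hyw2, if_false]
      rw [h6] at h3
      split_ifs <;> omega

end Paths

/-! ### One-step comparison of the process with the tandem -/

section Dynamics

variable {Ω : Type*} [mΩ : MeasurableSpace Ω] {p : ℤ → ℝ} {P : Measure Ω}
  {ℱ : Filtration ℝ≥0 mΩ} {N : ℤ → ℝ≥0 → Ω → ℕ}
  {η : ℝ≥0 → Ω → Config}

/-- The event that, during `(s, s + u]`, the clock at `z` rings `k z` times, for every `z ∈ J`. -/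
def ringEvent (N : ℤ → ℝ≥0 → Ω → ℕ) (J : Finset ℤ) (s u : ℝ≥0) (k : ℤ → ℕ) : Set Ω :=
  {ω | ∀ z ∈ J, N z (s + u) ω - N z s ω = k z}

theorem IsZeroRangeProcess.measure_ringEvent [IsProbabilityMeasure P]
    (h : IsZeroRangeProcess p ℱ N η P) (J : Finset ℤ)
    (s u : ℝ≥0) (k : ℤ → ℕ) :
    P.real (ringEvent N J s u k) = ∏ z ∈ J, (poissonMeasure ((p z).toNNReal * u)).real {k z} := by
  have h1 := h.indep_clocks.measure_inter_preimage_eq_mul J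
    (sets := fun z => {c : ℝ≥0 → ℕ | c (s + u) - c s = k z}) (fun z _ =>
      measurableSet_eq_fun (Measurable.sub (f := fun c : ℝ≥0 → ℕ => c (s + u))
        (g := fun c : ℝ≥0 → ℕ => c s) (measurable_pi_apply _) (measurable_pi_apply _))
        measurable_const)
  have h2 : ringEvent N J s u k =
      ⋂ z ∈ J, (fun (ω : Ω) (t : ℝ≥0) => N z t ω) ⁻¹' {c : ℝ≥0 → ℕ | c (s + u) - c s = k z} := by
    ext ω; simp [ringEvent]
  rw [Measure.real, h2, h1, ENNReal.toReal_prod]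
  refine Finset.prod_congr rfl fun z _ => ?_
  have h3 := (h.poisson z).increment_law s (s + u) le_self_add
  rw [add_tsub_cancel_left] at h3
  have hmeas : Measurable fun ω => N z (s + u) ω - N z s ω :=
    ((h.poisson z).measurable _).sub ((h.poisson z).measurable _)
  rw [Measure.real, ← h3, Measure.map_apply hmeas (measurableSet_singleton _)]
  rfl

theorem IsZeroRangeProcess.measurableSet_ringEvent (h : IsZeroRangeProcess p ℱ N η P)
    (J : Finset ℤ) (s u : ℝ≥0) (k : ℤ → ℕ) : MeasurableSet (ringEvent N J s u k) := by
  have h2 : ringEvent N J s u k = ⋂ z ∈ J, {ω | N z (s + u) ω - N z s ω = k z} := by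
    ext ω; simp [ringEvent]
  rw [h2]
  exact Finset.measurableSet_biInter _ fun z _ =>
    measurableSet_eq_fun (((h.poisson z).measurable _).sub ((h.poisson z).measurable _))
      measurable_const

theorem IsZeroRangeProcess.measurable_config (h : IsZeroRangeProcess p ℱ N η P) (t : ℝ≥0) :
    Measurable (η t) :=
  (h.adapted t).mono (ℱ.le t) le_rfl

/-- The future rings are independent of the present configuration. -/
theorem IsZeroRangeProcess.integral_indicator_ringEvent [IsProbabilityMeasure P]
    (h : IsZeroRangeProcess p ℱ N η P)
    (J : Finset ℤ) (s u : ℝ≥0) (k : ℤ → ℕ) {W : Finset ℤ} (G : (W → ℕ) → ℝ) :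
    ∫ ω, (ringEvent N J s u k).indicator (fun ω => G (W.restrict (η s ω))) ω ∂P =
      P.real (ringEvent N J s u k) * ∫ ω, G (W.restrict (η s ω)) ∂P := by
  have hG : Measurable fun ξ : Config => G (W.restrict ξ) :=
    (measurable_of_countable G).comp (Finset.measurable_restrict W)
  have hE := h.measurableSet_ringEvent J s u k
  have hind : IndepFun ((ringEvent N J s u k).indicator (1 : Ω → ℝ))
      (fun ω => G (W.restrict (η s ω))) P := by
    rw [IndepFun_iff_Indep]
    refine Indep.symm (indep_of_indep_of_le_left (indep_of_indep_of_le_right (h.indep_future s) ?_) ?_)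
    · rw [← measurable_iff_comap_le]
      refine (measurable_const (a := (1 : ℝ))).indicator ?_
      refine ⟨⋂ z ∈ J, {c : ℤ → ℝ≥0 → ℕ | c z u = k z}, ?_, ?_⟩
      · exact Finset.measurableSet_biInter _ fun z _ =>
          measurableSet_eq_fun ((measurable_pi_apply u).comp (measurable_pi_apply z))
            measurable_const
      · ext ω; simp [ringEvent]
    · rw [← measurable_iff_comap_le]
      exact hG.comp (h.adapted s)
  have h1 := hind.integral_fun_mul_eq_mul_integral
    ((measurable_const (a := (1 : ℝ))).indicator hE).aestronglyMeasurable
    (hG.comp (h.measurable_config s)).aestronglyMeasurable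
  rw [integral_indicator_one hE] at h1
  rw [← h1]
  refine integral_congr_ae (ae_of_all _ fun ω => ?_)
  by_cases hω : ω ∈ ringEvent N J s u k <;> simp [hω]

/-- Only silence and a single ring are controlled; the remaining clock behaviour has probability of
second order in `u`. -/
theorem IsZeroRangeProcess.ae_le (h : IsZeroRangeProcess p ℱ N η P) {x K : ℤ} (s u : ℝ≥0) :
    ∀ᵐ ω ∂P,
      (ω ∈ ringEvent N (Finset.Icc x K) s u 0 →
        (Finset.Ioc x K).restrict (η (s + u) ω) = (Finset.Ioc x K).restrict (η s ω)) ∧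
      ∀ w ∈ Finset.Icc x K, ω ∈ ringEvent N (Finset.Icc x K) s u (Pi.single w 1) →
        (Finset.Ioc x K).restrict (η (s + u) ω) ≤
          hop (Finset.Ioc x K) w ((Finset.Ioc x K).restrict (η s ω)) := by
  have hpaths := ae_all_iff.2 fun z => (h.poisson z).paths
  filter_upwards [hpaths, h.evolution] with ω hω hev
  have hsu : s ≤ s + u := le_self_add
  refine ⟨fun h0 => ?_, fun w hw h1 => ?_⟩
  · ext y
    refine restrict_eq_of_no_jump (n := fun z t => N z t ω) (e := fun t => η t ω)
      (fun z => (hω z).1) hev hsu (fun z hz => ?_) y y.2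
    have h2 := h0 z hz
    have h3 := (hω z).1 hsu
    simp only [Pi.zero_apply] at h2 h3
    omega
  · refine restrict_le_hop_of_single_jump (n := fun z t => N z t ω) (e := fun t => η t ω)
      (fun z => (hω z).1) (fun z => (hω z).2) hev hsu ?_ fun z hz hzw => ?_
    · have h2 := h1 w hw
      have h3 := (hω w).1 hsu
      simp only [Pi.single_eq_same] at h2 h3
      omega
    · have h2 := h1 z hz
      have h3 := (hω z).1 hsu
      simp only [Pi.single_eq_of_ne hzw] at h2 h3
      omega

/-- One step of the Euler scheme of the tandem dominates the process up to second order. -/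
theorem IsZeroRangeProcess.integral_le_step [IsProbabilityMeasure P]
    (h : IsZeroRangeProcess p ℱ N η P)
    (hp : ∀ z, 0 < p z) {x K : ℤ} {g : (Finset.Ioc x K → ℕ) → ℝ} {C : ℝ} (hmono : Monotone g)
    (hg : ∀ ξ, g ξ ∈ Set.Icc 0 C) (s u : ℝ≥0) :
    ∫ ω, g ((Finset.Ioc x K).restrict (η (s + u) ω)) ∂P ≤
      ∫ ω, tandemStep p x K u g ((Finset.Ioc x K).restrict (η s ω)) ∂P +
        C * (u * ∑ z ∈ Finset.Icc x K, p z) ^ 2 := by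
  set Λ := ∑ z ∈ Finset.Icc x K, p z with hΛ
  have hΛ0 : 0 ≤ Λ := Finset.sum_nonneg fun z _ => (hp z).le
  have hint : ∀ (t : ℝ≥0) (G : (Finset.Ioc x K → ℕ) → ℝ) (l v : ℝ), (∀ ξ, G ξ ∈ Set.Icc l v) →
      Integrable (fun ω => G ((Finset.Ioc x K).restrict (η t ω))) P := fun t G l v hG =>
    Integrable.of_mem_Icc l v (((measurable_of_countable G).comp
      (Finset.measurable_restrict _)).comp (h.measurable_config t)).aemeasurable
      (ae_of_all _ fun ω => hG _)
  set E0 := ringEvent N (Finset.Icc x K) s u 0 with hE0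
  set E1 := fun z : ℤ => ringEvent N (Finset.Icc x K) s u (Pi.single z 1) with hE1
  have hq0 : P.real E0 = Real.exp (-(u * Λ)) := by
    rw [hE0, h.measure_ringEvent]
    simp only [poissonMeasure_real_singleton, Pi.zero_apply, pow_zero, mul_one,
      Nat.factorial_zero, Nat.cast_one, div_one, NNReal.coe_mul]
    rw [← Real.exp_sum]
    congr 1
    rw [hΛ, Finset.mul_sum, ← Finset.sum_neg_distrib]
    exact Finset.sum_congr rfl fun z _ => by rw [Real.coe_toNNReal _ (hp z).le]; ring
  have hq1 : ∀ z ∈ Finset.Icc x K, P.real (E1 z) = u * p z * Real.exp (-(u * Λ)) := by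
    intro w hw
    rw [← hq0, hE0, h.measure_ringEvent, h.measure_ringEvent, ← Finset.mul_prod_erase _ _ hw,
      ← Finset.mul_prod_erase _ _ hw, ← mul_assoc]
    congr 1
    · simp [poissonMeasure_real_singleton, Real.coe_toNNReal _ (hp w).le]
      ring
    · refine Finset.prod_congr rfl fun z hz => ?_
      rw [Pi.single_eq_of_ne (Finset.ne_of_mem_erase hz)]
      rfl
  -- Working with `C - g ≥ 0` instead of `g` allows the event of several rings to be dropped: there
  -- the bound is just `g ≤ C`.
  set G0 : Ω → ℝ := E0.indicator fun ω =>
    (fun ξ => C - g ξ) ((Finset.Ioc x K).restrict (η s ω)) with hG0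
  set G1 : ℤ → Ω → ℝ := fun z => (E1 z).indicator fun ω =>
    (fun ξ => C - g (hop (Finset.Ioc x K) z ξ)) ((Finset.Ioc x K).restrict (η s ω)) with hG1
  have hC0 : ∀ ξ, C - g ξ ∈ Set.Icc 0 C := fun ξ =>
    ⟨by linarith [(hg ξ).2], by linarith [(hg ξ).1]⟩
  have hG0i : Integrable G0 P :=
    (hint s (fun ξ => C - g ξ) 0 C hC0).indicator (h.measurableSet_ringEvent _ _ _ _)
  have hG1i : ∀ z ∈ Finset.Icc x K, Integrable (G1 z) P := fun z _ =>
    (hint s (fun ξ => C - g (hop (Finset.Ioc x K) z ξ)) 0 C fun ξ => hC0 _).indicator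
      (h.measurableSet_ringEvent _ _ _ _)
  have hpt : ∀ᵐ ω ∂P, g ((Finset.Ioc x K).restrict (η (s + u) ω)) ≤
      C - (G0 ω + ∑ z ∈ Finset.Icc x K, G1 z ω) := by
    filter_upwards [h.ae_le (x := x) (K := K) s u] with ω hω
    by_cases h1 : ∃ w ∈ Finset.Icc x K, ω ∈ E1 w
    · obtain ⟨w, hw, hωw⟩ := h1
      have hn0 : ω ∉ E0 := by
        intro h0
        have e1 := h0 w hw
        have e2 := hωw w hw
        simp only [Pi.zero_apply, Pi.single_eq_same] at e1 e2
        omega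
      have hn1 : ∀ z ∈ Finset.Icc x K, z ≠ w → G1 z ω = 0 := by
        intro z hz hzw
        refine Set.indicator_of_notMem (fun hωz => ?_) _
        have e1 := hωz w hw
        have e2 := hωw w hw
        rw [Pi.single_eq_of_ne hzw.symm] at e1
        rw [Pi.single_eq_same] at e2
        omega
      rw [Finset.sum_eq_single_of_mem w hw hn1]
      simp only [hG0, hG1, Set.indicator_of_notMem hn0, Set.indicator_of_mem hωw]
      have := hmono (hω.2 w hw hωw)
      linarith
    · push Not at h1
      rw [Finset.sum_eq_zero fun z hz => Set.indicator_of_notMem (h1 z hz) _]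
      by_cases h0 : ω ∈ E0
      · simp only [hG0, Set.indicator_of_mem h0]
        rw [hω.1 h0]
        linarith
      · simp only [hG0, Set.indicator_of_notMem h0]
        linarith [(hg ((Finset.Ioc x K).restrict (η (s + u) ω))).2]
  have hsumi := integrable_finsetSum _ hG1i
  have hadd : Integrable (fun ω => G0 ω + ∑ z ∈ Finset.Icc x K, G1 z ω) P := hG0i.add hsumi
  have hsub : Integrable (fun ω => C - (G0 ω + ∑ z ∈ Finset.Icc x K, G1 z ω)) P :=
    (integrable_const C).sub hadd
  have hle := integral_mono_ae (hint _ g 0 C hg) hsub hpt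
  have hrhs : ∫ ω, (C - (G0 ω + ∑ z ∈ Finset.Icc x K, G1 z ω)) ∂P =
      C - (∫ ω, G0 ω ∂P + ∑ z ∈ Finset.Icc x K, ∫ ω, G1 z ω ∂P) := by
    rw [integral_sub (integrable_const C) hadd, integral_add hG0i hsumi,
      integral_finsetSum _ hG1i]
    simp
  have hexp : ∀ ζ, tandemStep p x K u g ζ = (1 - u * Λ) * g ζ +
      ∑ z ∈ Finset.Icc x K, u * p z * g (hop (Finset.Ioc x K) z ζ) := fun ζ => eulerStep_apply g ζ
  have hi1 : ∀ z ∈ Finset.Icc x K, Integrable (fun ω => u * p z *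
      g (hop (Finset.Ioc x K) z ((Finset.Ioc x K).restrict (η s ω)))) P := fun z _ =>
    (hint s (fun ξ => g (hop (Finset.Ioc x K) z ξ)) 0 C fun ξ => hg _).const_mul _
  simp only [hexp]
  rw [integral_add ((hint s g 0 C hg).const_mul _) (integrable_finsetSum _ hi1),
    integral_const_mul, integral_finsetSum _ hi1]
  simp only [integral_const_mul]
  have h0 : ∫ ω, G0 ω ∂P = Real.exp (-(u * Λ)) *
      (C - ∫ ω, g ((Finset.Ioc x K).restrict (η s ω)) ∂P) := by
    rw [← hq0]
    refine (h.integral_indicator_ringEvent _ s u 0 fun ξ => C - g ξ).trans ?_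
    rw [integral_sub (integrable_const _) (hint s g 0 C hg)]
    simp [hE0]
  have h1 : ∀ z ∈ Finset.Icc x K, ∫ ω, G1 z ω ∂P = u * p z * Real.exp (-(u * Λ)) *
      (C - ∫ ω, g (hop (Finset.Ioc x K) z ((Finset.Ioc x K).restrict (η s ω))) ∂P) := by
    intro z hz
    rw [← hq1 z hz]
    refine (h.integral_indicator_ringEvent _ s u (Pi.single z 1)
      fun ξ => C - g (hop (Finset.Ioc x K) z ξ)).trans ?_
    rw [integral_sub (integrable_const _) (hint s (fun ξ => g (hop (Finset.Ioc x K) z ξ)) 0 C fun ξ => hg _)]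
    simp [hE1]
  rw [hrhs, h0, Finset.sum_congr rfl h1] at hle
  refine hle.trans ?_
  have hav : ∀ φ : (Finset.Ioc x K → ℕ) → (Finset.Ioc x K → ℕ),
      ∫ ω, g (φ ((Finset.Ioc x K).restrict (η s ω))) ∂P ∈ Set.Icc 0 C := by
    intro φ
    refine ⟨integral_nonneg fun ω => (hg _).1, ?_⟩
    calc _ ≤ ∫ _, C ∂P := integral_mono (hint s (fun ξ => g (φ ξ)) 0 C fun ξ => hg _)
          (integrable_const _) fun ω => (hg _).2
      _ = C := by simp
  set q := Real.exp (-(u * Λ)) with hq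
  have hq_lb : 1 - u * Λ ≤ q := by have := Real.add_one_le_exp (-(u * Λ)); linarith
  have hq1' : q ≤ 1 := Real.exp_le_one_iff.2 (by
    have : 0 ≤ (u : ℝ) * Λ := mul_nonneg u.2 hΛ0
    linarith)
  have hA := hav id
  simp only [id] at hA
  set A := ∫ ω, g ((Finset.Ioc x K).restrict (η s ω)) ∂P
  set B : ℤ → ℝ := fun z =>
    ∫ ω, g (hop (Finset.Ioc x K) z ((Finset.Ioc x K).restrict (η s ω))) ∂P with hB
  have hBz : ∀ z, B z ∈ Set.Icc 0 C := fun z => hav (hop (Finset.Ioc x K) z)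
  -- The quadratic error comes from replacing the factor `q` by one in the single-ring terms, since
  -- `1 - q ≤ u * Λ`. The idle term costs nothing, because `1 - u * Λ ≤ q` and `A ≤ C`.
  have hsum : ∑ z ∈ Finset.Icc x K, u * p z * (C - B z) * (1 - q) ≤ C * (u * Λ) ^ 2 := by
    calc ∑ z ∈ Finset.Icc x K, u * p z * (C - B z) * (1 - q)
        ≤ ∑ z ∈ Finset.Icc x K, u * p z * (C * (u * Λ)) := by
          refine Finset.sum_le_sum fun z _ => ?_
          rw [mul_assoc]
          refine mul_le_mul_of_nonneg_left ?_ (mul_nonneg u.2 (hp z).le)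
          exact mul_le_mul (by linarith [(hBz z).1]) (by linarith) (by linarith)
            ((hBz z).1.trans (hBz z).2)
      _ = C * (u * Λ) ^ 2 := by
          rw [← Finset.sum_mul, ← Finset.mul_sum]; ring
  have hsplit : ∑ z ∈ Finset.Icc x K, u * p z * (C - B z) * (1 - q) =
      u * Λ * C - ∑ z ∈ Finset.Icc x K, u * p z * B z -
        ∑ z ∈ Finset.Icc x K, u * p z * q * (C - B z) := by
    rw [hΛ, Finset.mul_sum, Finset.sum_mul, ← Finset.sum_sub_distrib, ← Finset.sum_sub_distrib]
    exact Finset.sum_congr rfl fun z _ => by ring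
  nlinarith [mul_nonneg (sub_nonneg.2 hq_lb) (sub_nonneg.2 hA.2)]

end Dynamics

/-! ### Local functions, and continuity of the product laws in the parameter -/

section Windows

/-- The configuration that agrees with `ξ` on `B` and is empty elsewhere. -/
def extendByZero (B : Finset ℤ) (ξ : B → ℕ) : Config :=
  fun z => if hz : z ∈ B then ξ ⟨z, hz⟩ else 0

theorem extendByZero_monotone (B : Finset ℤ) : Monotone (extendByZero B) := by
  intro ξ ζ h z
  unfold extendByZero
  split_ifs with hz
  · exact h ⟨z, hz⟩
  · exact le_rfl

theorem extendByZero_restrict {f : Config → ℝ} {A B : Finset ℤ} (hf : DependsOn f (A : Set ℤ))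
    (hAB : A ⊆ B) (ξ : Config) : f (extendByZero B (B.restrict ξ)) = f ξ := by
  refine hf fun z hz => ?_
  have : z ∈ B := hAB hz
  simp [extendByZero, this]

theorem integral_infinitePi_of_dependsOn {f : Config → ℝ} {A B : Finset ℤ}
    (hf : DependsOn f (A : Set ℤ)) (hAB : A ⊆ B) (μ : ℤ → Measure ℕ)
    [∀ z, IsProbabilityMeasure (μ z)] :
    ∫ ξ, f ξ ∂(Measure.infinitePi μ) =
      ∫ ξ, f (extendByZero B ξ) ∂(Measure.pi fun z : B => μ z) := by
  refine Eq.trans ?_ (integral_restrict_infinitePi (μ := μ) (s := B)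
    (f := fun ξ : B → ℕ => f (extendByZero B ξ)) (measurable_of_countable _).aestronglyMeasurable)
  simp only [extendByZero_restrict hf hAB]

/-- Integrals of local functions against the stationary law of a tandem only involve the sites on
which the function depends. -/
theorem integral_tandemLaw_of_dependsOn {p : ℤ → ℝ} (hp : ∀ z, 0 < p z) {x K : ℤ}
    (hlt : ∀ z ∈ Finset.Ioc x K, p x < p z) {f : Config → ℝ} {A : Finset ℤ}
    (hf : DependsOn f (A : Set ℤ)) (hA : A ⊆ Finset.Ioc x K) :
    ∫ ξ, f (extendByZero (Finset.Ioc x K) ξ) ∂(tandemLaw p x K) =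
      ∫ ξ, f (extendByZero A ξ) ∂(Measure.pi fun y : A => geometricLaw (p x / p y)) := by
  -- Parameter zero off the window gives probability measures at all sites, so that both sides
  -- become marginals of one infinite product.
  set r : ℤ → ℝ := fun z => if z ∈ Finset.Ioc x K then p x / p z else 0 with hr
  have hprob : ∀ z, IsProbabilityMeasure (geometricLaw (r z)) := by
    intro z
    by_cases hz : z ∈ Finset.Ioc x K
    · simp only [hr, hz, if_true]
      exact isProbabilityMeasure_geometricLaw (div_nonneg (hp x).le (hp z).le)
        ((div_lt_one (hp z)).2 (hlt z hz))
    · simp only [hr, hz, if_false]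
      exact isProbabilityMeasure_geometricLaw le_rfl one_pos
  have h1 : tandemLaw p x K = Measure.pi fun y : Finset.Ioc x K => geometricLaw (r y) := by
    unfold tandemLaw
    congr 1
    ext1 y
    rw [hr]
    simp only [y.2, if_true]
  have h2 : (Measure.pi fun y : A => geometricLaw (p x / p y)) =
      Measure.pi fun y : A => geometricLaw (r y) := by
    congr 1
    ext1 y
    rw [hr]
    simp only [hA y.2, if_true]
  rw [h1, h2, ← integral_infinitePi_of_dependsOn hf hA fun z => geometricLaw (r z),
    ← integral_infinitePi_of_dependsOn hf subset_rfl fun z => geometricLaw (r z)]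

/-- Integrals of bounded functions against product geometric laws are continuous in the
parameter. -/
theorem tendsto_integral_pi_geometricLaw {ι : Type*} [Fintype ι] {q : ι → ℝ} {c : ℝ}
    (hc : 0 < c) (hq : ∀ i, c < q i) {g : (ι → ℕ) → ℝ} {C : ℝ}
    (hg : ∀ ξ, g ξ ∈ Set.Icc 0 C) :
    Tendsto (fun v : ℝ => ∫ ξ, g ξ ∂(Measure.pi fun i => geometricLaw (v / q i))) (𝓝 c)
      (𝓝 (∫ ξ, g ξ ∂(Measure.pi fun i => geometricLaw (c / q i)))) := by
  have hC : 0 ≤ C := (hg 0).1.trans (hg 0).2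
  -- A reference parameter strictly between `c` and all the `q i`: the laws with `0 ≤ v ≤ w` have
  -- densities `ρ v` with respect to the law at `w`, uniformly bounded by `M`, and dominated
  -- convergence applies.
  obtain ⟨w, hwq, hcw⟩ : ∃ w, (∀ i, w < q i) ∧ c < w := by
    have h1 : ∀ᶠ w in 𝓝[>] c, ∀ i, w < q i := eventually_all.2 fun i =>
      mem_nhdsWithin_of_mem_nhds (eventually_lt_nhds (hq i))
    obtain ⟨w, hw⟩ := (h1.and self_mem_nhdsWithin).exists
    exact ⟨w, hw.1, hw.2⟩
  have hw0 : 0 < w := hc.trans hcw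
  have hq0 : ∀ i, 0 < q i := fun i => hc.trans (hq i)
  have hr0 : ∀ v, 0 ≤ v → ∀ i, 0 ≤ v / q i := fun v hv i => div_nonneg hv (hq0 i).le
  have hr1 : ∀ v, v ≤ w → ∀ i, v / q i < 1 := fun v hv i =>
    (div_lt_one (hq0 i)).2 (hv.trans_lt (hwq i))
  have hprob : ∀ v, 0 ≤ v → v ≤ w →
      IsProbabilityMeasure (Measure.pi fun i => geometricLaw (v / q i)) := fun v h0 h1 => by
    have := fun i => isProbabilityMeasure_geometricLaw (hr0 v h0 i) (hr1 v h1 i)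
    infer_instance
  have := hprob w hw0.le le_rfl
  set ρ : ℝ → (ι → ℕ) → ℝ := fun v ξ =>
    ∏ i, ((v / w) ^ ξ i * ((1 - v / q i) / (1 - w / q i))) with hρ
  set M := ∏ i, (1 / (1 - w / q i)) with hM
  have hden : ∀ i, 0 < 1 - w / q i := fun i => by linarith [hr1 w le_rfl i]
  have hM0 : 0 ≤ M := Finset.prod_nonneg fun i _ => (one_div_pos.2 (hden i)).le
  have hρ_mem : ∀ v, 0 ≤ v → v ≤ w → ∀ ξ, ρ v ξ ∈ Set.Icc 0 M := by
    intro v h0 h1 ξ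
    have hnum : ∀ i, 0 ≤ (1 - v / q i) / (1 - w / q i) := fun i =>
      div_nonneg (by linarith [hr1 v h1 i]) (hden i).le
    have hvw : 0 ≤ v / w := div_nonneg h0 hw0.le
    refine ⟨Finset.prod_nonneg fun i _ => mul_nonneg (pow_nonneg hvw _) (hnum i),
      Finset.prod_le_prod (fun i _ => mul_nonneg (pow_nonneg hvw _) (hnum i)) fun i _ => ?_⟩
    calc (v / w) ^ ξ i * ((1 - v / q i) / (1 - w / q i))
        ≤ 1 * ((1 - v / q i) / (1 - w / q i)) :=
          mul_le_mul_of_nonneg_right (pow_le_one₀ hvw ((div_le_one hw0).2 h1)) (hnum i)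
      _ ≤ 1 / (1 - w / q i) := by
          rw [one_mul]
          exact div_le_div_of_nonneg_right (by linarith [hr0 v h0 i]) (hden i).le
  have hprod_mem : ∀ v, 0 ≤ v → v ≤ w → ∀ ξ, ρ v ξ * g ξ ∈ Set.Icc 0 (M * C) :=
    fun v h0 h1 ξ => ⟨mul_nonneg (hρ_mem v h0 h1 ξ).1 (hg ξ).1,
      mul_le_mul (hρ_mem v h0 h1 ξ).2 (hg ξ).2 (hg ξ).1 hM0⟩
  have hdensity : ∀ v, 0 ≤ v → v ≤ w →
      ∫ ξ, g ξ ∂(Measure.pi fun i => geometricLaw (v / q i)) =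
        ∫ ξ, ρ v ξ * g ξ ∂(Measure.pi fun i => geometricLaw (w / q i)) := by
    intro v h0 h1
    have := hprob v h0 h1
    rw [integral_countable (integrable_of_mem_Icc hg),
      integral_countable (integrable_of_mem_Icc (hprod_mem v h0 h1))]
    refine tsum_congr fun ξ => ?_
    rw [pi_geometricLaw_real_singleton (hr0 v h0) (hr1 v h1),
      pi_geometricLaw_real_singleton (hr0 w hw0.le) (hr1 w le_rfl), smul_eq_mul, smul_eq_mul,
      ← mul_assoc]
    congr 1
    rw [← Finset.prod_mul_distrib]
    refine Finset.prod_congr rfl fun i _ => ?_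
    have h2 := (hden i).ne'
    have h4 : (v / q i) ^ ξ i = (w / q i) ^ ξ i * (v / w) ^ ξ i := by
      rw [← mul_pow]
      congr 1
      have := (hq0 i).ne'
      field_simp
    rw [h4]
    field_simp
  have hnear : ∀ᶠ v in 𝓝 c, 0 ≤ v ∧ v ≤ w :=
    (eventually_ge_nhds hc).and (eventually_le_nhds hcw)
  rw [hdensity c hc.le hcw.le]
  refine Tendsto.congr' (hnear.mono fun v hv => (hdensity v hv.1 hv.2).symm) ?_
  refine tendsto_integral_filter_of_dominated_convergence (fun _ => M * C)
    (Eventually.of_forall fun v => (measurable_of_countable _).aestronglyMeasurable)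
    (hnear.mono fun v hv => ae_of_all _ fun ξ => ?_) (integrable_const _)
    (ae_of_all _ fun ξ => ?_)
  · rw [Real.norm_eq_abs, abs_of_nonneg (hprod_mem v hv.1 hv.2 ξ).1]
    exact (hprod_mem v hv.1 hv.2 ξ).2
  · refine Tendsto.mul_const _ ?_
    have : Continuous fun v => ρ v ξ := by
      simp only [hρ]
      fun_prop
    exact this.tendsto c

end Windows

/-! ### Long-time comparison -/

section Comparison

variable {Ω : Type*} [mΩ : MeasurableSpace Ω] {p : ℤ → ℝ} {P : Measure Ω}
  [IsProbabilityMeasure P] {ℱ : Filtration ℝ≥0 mΩ} {N : ℤ → ℝ≥0 → Ω → ℕ}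
  {η : ℝ≥0 → Ω → Config} {x K : ℤ} {g : (Finset.Ioc x K → ℕ) → ℝ} {C : ℝ}

theorem IsZeroRangeProcess.integrable_restrict (h : IsZeroRangeProcess p ℱ N η P)
    {W : Finset ℤ} {G : (W → ℕ) → ℝ} {l v : ℝ} (hG : ∀ ξ, G ξ ∈ Set.Icc l v) (t : ℝ≥0) :
    Integrable (fun ω => G (W.restrict (η t ω))) P :=
  Integrable.of_mem_Icc l v (((measurable_of_countable G).comp
    (Finset.measurable_restrict _)).comp (h.measurable_config t)).aemeasurable
    (ae_of_all _ fun _ => hG _)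

/-- An Euler step of `g` is again monotone with values in `[0, C]`, so the one-step error keeps the
same constant and the errors simply add up. -/
theorem IsZeroRangeProcess.integral_le_pow (h : IsZeroRangeProcess p ℱ N η P)
    (hp : ∀ z, 0 < p z) {u : ℝ≥0} (hu : u * ∑ z ∈ Finset.Icc x K, p z ≤ 1)
    (hmono : Monotone g) (hg : ∀ ξ, g ξ ∈ Set.Icc 0 C) (n : ℕ) :
    ∫ ω, g ((Finset.Ioc x K).restrict (η (n * u) ω)) ∂P ≤
      ∫ ω, (tandemStep p x K u ^ n) g ((Finset.Ioc x K).restrict (η 0 ω)) ∂P +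
        n * (C * (u * ∑ z ∈ Finset.Icc x K, p z) ^ 2) := by
  induction n generalizing g with
  | zero => simp
  | succ n ih =>
    have h1 := h.integral_le_step hp hmono hg (n * u) u
    have h2 := ih (g := tandemStep p x K u g) (eulerStep_monotone (fun z _ => (hp z).le) u.2 hu hop_monotone hmono)
      (eulerStep_mem_Icc (fun z _ => (hp z).le) u.2 hu hg)
    have h3 : ((n + 1 : ℕ) : ℝ≥0) * u = n * u + u := by push_cast; ring
    rw [h3, pow_succ]
    refine (h1.trans (add_le_add_left h2 _)).trans (le_of_eq ?_)
    rw [Module.End.mul_apply]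
    push_cast
    ring

/-- The process is dominated by the tandem run for a binomial number of steps of a fixed size. -/
theorem IsZeroRangeProcess.integral_le_binomial (h : IsZeroRangeProcess p ℱ N η P)
    (hp : ∀ z, 0 < p z) {u : ℝ} (hu0 : 0 < u) (hu : u * ∑ z ∈ Finset.Icc x K, p z ≤ 1)
    (hmono : Monotone g) (hg : ∀ ξ, g ξ ∈ Set.Icc 0 C) (t : ℝ≥0) {n : ℕ} (hn0 : 0 < n)
    (hn : t / u ≤ n) :
    ∫ ω, g ((Finset.Ioc x K).restrict (η t ω)) ∂P ≤
      ∑ k ∈ Finset.range (n + 1), (t / u / n) ^ k * (1 - t / u / n) ^ (n - k) * n.choose k *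
        ∫ ω, (tandemStep p x K u ^ k) g ((Finset.Ioc x K).restrict (η 0 ω)) ∂P +
      C * (t * ∑ z ∈ Finset.Icc x K, p z) ^ 2 / n := by
  have hn' : (0 : ℝ) < n := by exact_mod_cast hn0
  have hΛ : 0 ≤ ∑ z ∈ Finset.Icc x K, p z := Finset.sum_nonneg fun z _ => (hp z).le
  have hstep : ((t / n : ℝ≥0) : ℝ) = (t / u / n) * u := by
    push_cast
    field_simp
  have hsmall : ((t / n : ℝ≥0) : ℝ) * ∑ z ∈ Finset.Icc x K, p z ≤ 1 := by
    refine le_trans (mul_le_mul_of_nonneg_right ?_ hΛ) hu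
    rw [hstep]
    exact mul_le_of_le_one_left hu0.le ((div_le_one hn').2 hn)
  have h1 := h.integral_le_pow hp hsmall hmono hg n
  have h2 : (n : ℝ≥0) * (t / n) = t := by
    have : (n : ℝ≥0) ≠ 0 := by exact_mod_cast hn0.ne'
    field_simp
  rw [h2] at h1
  refine h1.trans (le_of_eq ?_)
  congr 1
  · rw [hstep, tandemStep, eulerStep_mul_pow]
    simp only [LinearMap.sum_apply, LinearMap.smul_apply, Finset.sum_apply, Pi.smul_apply,
      smul_eq_mul]
    rw [integral_finsetSum]
    · simp only [integral_const_mul]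
    · intro k _
      exact (h.integrable_restrict
        (eulerStep_pow_mem_Icc (fun z _ => (hp z).le) hu0.le hu hg k) 0).const_mul _
  · push_cast
    field_simp

theorem exists_step_size (hp : ∀ z, 0 < p z) :
    ∃ u : ℝ, 0 < u ∧ u * ∑ z ∈ Finset.Icc x K, p z < 1 := by
  have hΛ : 0 ≤ ∑ z ∈ Finset.Icc x K, p z := Finset.sum_nonneg fun z _ => (hp z).le
  refine ⟨1 / (1 + ∑ z ∈ Finset.Icc x K, p z), by positivity, ?_⟩
  rw [one_div_mul_eq_div, div_lt_one (by positivity)]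
  linarith

/-- Asymptotically, the process is dominated by the stationary law of the tandem. -/
theorem IsZeroRangeProcess.eventually_integral_le (h : IsZeroRangeProcess p ℱ N η P)
    (hp : ∀ z, 0 < p z) (hxK : x ≤ K) (hlt : ∀ z ∈ Finset.Ioc x K, p x < p z)
    (hmono : Monotone g) (hg : ∀ ξ, g ξ ∈ Set.Icc 0 C) {ε : ℝ} (hε : 0 < ε) :
    ∀ᶠ t : ℝ≥0 in atTop, ∫ ω, g ((Finset.Ioc x K).restrict (η t ω)) ∂P ≤
      ∫ ξ, g ξ ∂(tandemLaw p x K) + ε := by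
  obtain ⟨u, hu0, hu⟩ := exists_step_size (x := x) (K := K) hp
  have hC : 0 ≤ C := (hg 0).1.trans (hg 0).2
  have hpow : ∀ k ξ, (tandemStep p x K u ^ k) g ξ ∈ Set.Icc 0 C :=
    eulerStep_pow_mem_Icc (fun z _ => (hp z).le) hu0.le hu.le hg
  have hlim : Tendsto (fun k : ℕ =>
      ∫ ω, (tandemStep p x K u ^ k) g ((Finset.Ioc x K).restrict (η 0 ω)) ∂P) atTop
      (𝓝 (∫ ξ, g ξ ∂(tandemLaw p x K))) := by
    have h1 := tendsto_integral_of_dominated_convergence (μ := P) (fun _ => C)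
      (F := fun (k : ℕ) ω => (tandemStep p x K u ^ k) g ((Finset.Ioc x K).restrict (η 0 ω)))
      (f := fun _ => ∫ ξ, g ξ ∂(tandemLaw p x K))
      (fun k => (h.integrable_restrict (hpow k) 0).aestronglyMeasurable) (integrable_const _)
      (fun k => ae_of_all _ fun ω => by
        rw [Real.norm_eq_abs, abs_of_nonneg (hpow k _).1]
        exact (hpow k _).2)
      (ae_of_all _ fun ω => tendsto_tandemStep_pow (C := C) hp hxK hlt hu0 hu
        (fun ξ => ⟨by linarith [(hg ξ).1], (hg ξ).2⟩) _)
    simpa using h1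
  have hle : ∀ k, ∫ ω, (tandemStep p x K u ^ k) g ((Finset.Ioc x K).restrict (η 0 ω)) ∂P ≤ C := by
    intro k
    calc _ ≤ ∫ _, C ∂P := integral_mono (h.integrable_restrict (hpow k) 0)
          (integrable_const _) fun ω => (hpow k _).2
      _ = C := by simp
  have hbin := eventually_binomial_average_le hle hlim hε
  have htime : Tendsto (fun t : ℝ≥0 => (t : ℝ) / u) atTop atTop :=
    (NNReal.tendsto_coe_atTop.2 tendsto_id).atTop_div_const hu0
  filter_upwards [htime.eventually hbin] with t ht
  -- At fixed `t` the number of steps `n` tends to infinity and removes the discretisation error;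
  -- the binomial bound `ht` is uniform in `n`.
  have herr : Tendsto (fun n : ℕ => ∫ ξ, g ξ ∂(tandemLaw p x K) + ε +
      C * (t * ∑ z ∈ Finset.Icc x K, p z) ^ 2 / n) atTop
      (𝓝 (∫ ξ, g ξ ∂(tandemLaw p x K) + ε + 0)) :=
    tendsto_const_nhds.add (tendsto_const_div_atTop_nhds_zero_nat _)
  rw [add_zero] at herr
  refine ge_of_tendsto herr ?_
  filter_upwards [eventually_gt_atTop 0,
    tendsto_natCast_atTop_atTop.eventually_ge_atTop ((t : ℝ) / u)] with n hn0 hn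
  exact (h.integral_le_binomial hp hu0 hu.le hmono hg t hn0 hn).trans
    (add_le_add_left (ht n hn) _)

/-- Bounds on the tandem that are uniform in time are inherited by the process. -/
theorem IsZeroRangeProcess.integral_le_of_forall_pow (h : IsZeroRangeProcess p ℱ N η P)
    (hp : ∀ z, 0 < p z) {u : ℝ} (hu0 : 0 < u) (hu : u * ∑ z ∈ Finset.Icc x K, p z ≤ 1)
    (hmono : Monotone g) (hg : ∀ ξ, g ξ ∈ Set.Icc 0 C) {M : ℝ}
    (hM : ∀ k : ℕ,
      ∫ ω, (tandemStep p x K u ^ k) g ((Finset.Ioc x K).restrict (η 0 ω)) ∂P ≤ M) (t : ℝ≥0) :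
    ∫ ω, g ((Finset.Ioc x K).restrict (η t ω)) ∂P ≤ M := by
  have herr : Tendsto (fun n : ℕ => M + C * (t * ∑ z ∈ Finset.Icc x K, p z) ^ 2 / n) atTop
      (𝓝 (M + 0)) :=
    tendsto_const_nhds.add (tendsto_const_div_atTop_nhds_zero_nat _)
  rw [add_zero] at herr
  refine ge_of_tendsto herr ?_
  filter_upwards [eventually_gt_atTop 0,
    tendsto_natCast_atTop_atTop.eventually_ge_atTop ((t : ℝ) / u)] with n hn0 hn
  refine (h.integral_le_binomial hp hu0 hu hmono hg t hn0 hn).trans (add_le_add_left ?_ _)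
  have hn' : (0 : ℝ) < n := by exact_mod_cast hn0
  have hb0 : 0 ≤ t / u / n := by positivity
  have hb1 : t / u / n ≤ 1 := (div_le_one hn').2 hn
  generalize t / u / n = b at *
  calc _ ≤ ∑ k ∈ Finset.range (n + 1), b ^ k * (1 - b) ^ (n - k) * n.choose k * M :=
        Finset.sum_le_sum fun k _ => mul_le_mul_of_nonneg_left (hM k) (by
          have : 0 ≤ 1 - b := by linarith
          positivity)
    _ = M := by
        rw [← Finset.sum_mul, ← add_pow]
        simp

/-- The number of particles at a site is tight, uniformly in time. -/
theorem IsZeroRangeProcess.exists_forall_measure_lt_le (h : IsZeroRangeProcess p ℱ N η P)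
    (hp : ∀ z, 0 < p z) {y : ℤ} (hxy : x < y) (hlt : ∀ z ∈ Finset.Ioc x y, p x < p z)
    {ε : ℝ} (hε : 0 < ε) : ∃ m : ℕ, ∀ t, P.real {ω | m < η t ω y} ≤ ε := by
  have hπ := isProbabilityMeasure_tandemLaw hp hlt
  obtain ⟨u, hu0, hu⟩ := exists_step_size (x := x) (K := y) hp
  have hy : y ∈ Finset.Ioc x y := Finset.mem_Ioc.2 ⟨hxy, le_rfl⟩
  set G : ℕ → (Finset.Ioc x y → ℕ) → ℝ := fun m ξ => if m < ξ ⟨y, hy⟩ then 1 else 0 with hG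
  have hGm : ∀ m ξ, G m ξ ∈ Set.Icc 0 1 := by
    intro m ξ
    simp only [hG]
    split_ifs <;> simp
  have hGmono : ∀ m, Monotone (G m) := by
    intro m ξ ζ hξ
    have : ξ ⟨y, hy⟩ ≤ ζ ⟨y, hy⟩ := hξ _
    simp only [hG]
    split_ifs
    · exact le_rfl
    · omega
    · exact zero_le_one
    · exact le_rfl
  have hpow : ∀ m k ξ, (tandemStep p x y u ^ k) (G m) ξ ∈ Set.Icc 0 1 := fun m =>
    eulerStep_pow_mem_Icc (fun z _ => (hp z).le) hu0.le hu.le (hGm m)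
  have hmass : ∀ m k, ∫ ξ, (tandemStep p x y u ^ k) (G m) ξ ∂(tandemLaw p x y) =
      ∫ ξ, G m ξ ∂(tandemLaw p x y) := by
    intro m k
    induction k with
    | zero => simp
    | succ k ih =>
      rw [← ih, pow_succ']
      exact integral_tandemStep (C := 1) hp hxy.le hlt u fun ξ =>
        ⟨by linarith [(hpow m k ξ).1], (hpow m k ξ).2⟩
  have hmean : Tendsto (fun m => ∫ ξ, G m ξ ∂(tandemLaw p x y)) atTop (𝓝 0) := by
    have h1 := tendsto_integral_of_dominated_convergence (μ := tandemLaw p x y) (fun _ => (1 : ℝ))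
      (F := G) (f := fun _ => 0)
      (fun m => (measurable_of_countable _).aestronglyMeasurable) (integrable_const _)
      (fun m => ae_of_all _ fun ξ => by
        rw [Real.norm_eq_abs, abs_of_nonneg (hGm m ξ).1]
        exact (hGm m ξ).2)
      (ae_of_all _ fun ξ => by
        refine tendsto_const_nhds.congr' ?_
        filter_upwards [eventually_ge_atTop (ξ ⟨y, hy⟩)] with m hm
        simp only [hG, not_lt.2 hm, if_false])
    simpa using h1
  -- A bound on the iterates that does not depend on their number: stationary mean divided by the
  -- mass of the atom. The cut-off at one makes it integrable under an arbitrary initial law.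
  set V : ℕ → (Finset.Ioc x y → ℕ) → ℝ := fun m ξ =>
    min 1 ((∫ ζ, G m ζ ∂(tandemLaw p x y)) / (tandemLaw p x y).real {ξ}) with hV
  have hVm : ∀ m ξ, V m ξ ∈ Set.Icc 0 1 := fun m ξ =>
    ⟨le_min zero_le_one (div_nonneg (integral_nonneg fun ζ => (hGm m ζ).1) measureReal_nonneg),
      min_le_left _ _⟩
  have hpowV : ∀ m k ξ, (tandemStep p x y u ^ k) (G m) ξ ≤ V m ξ := by
    intro m k ξ
    refine le_min (hpow m k ξ).2 ?_
    have hpos : 0 < (tandemLaw p x y).real {ξ} := by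
      rw [Measure.real, ENNReal.toReal_pos_iff]
      exact ⟨pos_iff_ne_zero.2 (tandemLaw_singleton_ne_zero hp hlt ξ), measure_lt_top _ _⟩
    rw [le_div_iff₀ hpos, ← hmass m k]
    calc _ = ∫ ζ in {ξ}, (tandemStep p x y u ^ k) (G m) ζ ∂(tandemLaw p x y) := by
          rw [integral_singleton, smul_eq_mul, mul_comm]
      _ ≤ _ := setIntegral_le_integral (integrable_of_mem_Icc (hpow m k))
          (ae_of_all _ fun ζ => (hpow m k ζ).1)
  have hVlim : Tendsto (fun m => ∫ ω, V m ((Finset.Ioc x y).restrict (η 0 ω)) ∂P) atTop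
      (𝓝 0) := by
    have h1 := tendsto_integral_of_dominated_convergence (μ := P) (fun _ => (1 : ℝ))
      (F := fun m ω => V m ((Finset.Ioc x y).restrict (η 0 ω))) (f := fun _ => 0)
      (fun m => (h.integrable_restrict (hVm m) 0).aestronglyMeasurable) (integrable_const _)
      (fun m => ae_of_all _ fun ω => by
        rw [Real.norm_eq_abs, abs_of_nonneg (hVm m _).1]
        exact (hVm m _).2)
      (ae_of_all _ fun ω => by
        refine squeeze_zero (fun m => (hVm m _).1) (fun m => min_le_right _ _) ?_
        simpa using hmean.div_const _)
    simpa using h1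
  obtain ⟨m, hm⟩ := (hVlim.eventually_le_const hε).exists
  refine ⟨m, fun t => ?_⟩
  have h2 := h.integral_le_of_forall_pow hp hu0 hu.le (hGmono m) (hGm m) (fun k =>
    (integral_mono (h.integrable_restrict (hpow m k) 0) (h.integrable_restrict (hVm m) 0)
      fun ω => hpowV m k _).trans hm) t
  have hmeas : MeasurableSet {ω | m < η t ω y} :=
    measurableSet_lt measurable_const ((measurable_pi_apply y).comp (h.measurable_config t))
  rw [← integral_indicator_one hmeas]
  refine le_trans (le_of_eq (integral_congr_ae (ae_of_all _ fun ω => ?_))) h2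
  by_cases hω : m < η t ω y
  · simp [hG, hω]
  · simp [hG, hω]

end Comparison

/-! ### Choice of the slow site -/

/-- A site far to the left at which the rate is smaller than at all sites between it and `K`. -/
theorem exists_slow_site {c : ℝ} {p : ℤ → ℝ} (hpc : ∀ x, c < p x) (hp1 : ∀ x, p x ≤ 1)
    (hlim : liminf p atBot = c) (a K : ℤ) {v : ℝ} (hv : c < v) :
    ∃ x < a, x ≤ K ∧ p x < v ∧ ∀ z ∈ Finset.Ioc x K, p x < p z := by
  -- Keeping `w` below all rates on `[a, K]` forces any site of `(-∞, K]` with rate below `w` to lie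
  -- to the left of `a`.
  obtain ⟨w, hcw, hwv, hw⟩ : ∃ w, c < w ∧ w ≤ v ∧ ∀ z ∈ Finset.Icc a K, w ≤ p z := by
    have h1 : ∀ᶠ w in 𝓝[>] c, ∀ z ∈ Finset.Icc a K, w ≤ p z :=
      (Finset.eventually_all _).2 fun z _ =>
        mem_nhdsWithin_of_mem_nhds (eventually_le_nhds (hpc z))
    have h2 : ∀ᶠ w in 𝓝[>] c, w ≤ v := mem_nhdsWithin_of_mem_nhds (eventually_le_nhds hv)
    obtain ⟨w, hw⟩ := ((h1.and h2).and self_mem_nhdsWithin).exists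
    exact ⟨w, hw.2, hw.1.2, hw.1.1⟩
  have hfreq : ∃ᶠ x in atBot, p x < w := by
    refine frequently_lt_of_liminf_lt ?_ (by rwa [hlim])
    exact (isBoundedUnder_of ⟨1, hp1⟩ : IsBoundedUnder (· ≤ ·) atBot p).isCoboundedUnder_ge
  obtain ⟨x₀, hx₀, hx₀K⟩ := (hfreq.and_eventually (eventually_le_atBot (min K (a - 1)))).exists
  -- For the rightmost site up to `K` with rate below `w`, every site between it and `K` has rate at
  -- least `w`, hence strictly larger.
  obtain ⟨x, ⟨hx, hxK⟩, hmax⟩ := Int.exists_greatest_of_bdd (P := fun x => p x < w ∧ x ≤ K)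
    ⟨K, fun z hz => hz.2⟩ ⟨x₀, hx₀, hx₀K.trans (min_le_left _ _)⟩
  refine ⟨x, ?_, hxK, hx.trans_le hwv, fun z hz => ?_⟩
  · by_contra hax
    exact absurd (hw x (Finset.mem_Icc.2 ⟨not_lt.1 hax, hxK⟩)) (not_le.2 hx)
  · rw [Finset.mem_Ioc] at hz
    by_contra hlt
    have := hmax z ⟨(not_lt.1 hlt).trans_lt hx, hz.2⟩
    omega

theorem continuous_of_dependsOn {f : Config → ℝ} {A : Finset ℤ}
    (hf : DependsOn f (A : Set ℤ)) : Continuous f := by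
  have h1 : f = (fun ξ : A → ℕ => f (extendByZero A ξ)) ∘ A.restrict := by
    ext ξ
    exact (extendByZero_restrict hf subset_rfl ξ).symm
  rw [h1]
  exact continuous_of_discreteTopology.comp
    (continuous_pi fun z => continuous_apply (z : ℤ))

/-! ### Tightness and domination of the limits -/

section Main

variable {Ω : Type*} [mΩ : MeasurableSpace Ω] {c : ℝ} {p : ℤ → ℝ} {P : Measure Ω}
  [IsProbabilityMeasure P] {ℱ : Filtration ℝ≥0 mΩ} {N : ℤ → ℝ≥0 → Ω → ℕ}
  {η : ℝ≥0 → Ω → Config}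

/-- One-site tail bounds with summable errors suffice, since a product of finite sets is compact.
Each site `y` uses its own window ending at `y`, and the source needs no rate close to `c`. -/
theorem IsZeroRangeProcess.isTightMeasureSet (h : IsZeroRangeProcess p ℱ N η P) (hc : 0 < c)
    (hpc : ∀ x, c < p x) (hp1 : ∀ x, p x ≤ 1) (hlim : liminf p atBot = c) :
    IsTightMeasureSet {m : Measure Config | ∃ t : ℝ≥0, 0 < t ∧ m = h.law t} := by
  have hp : ∀ z, 0 < p z := fun z => hc.trans (hpc z)
  rw [isTightMeasureSet_iff_exists_isCompact_measure_compl_le]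
  intro ε hε
  obtain ⟨δ, hδ, hsum⟩ := ENNReal.exists_pos_sum_of_countable' hε.ne' ℤ
  have hsite : ∀ y : ℤ, ∃ m : ℕ, ∀ t, P {ω | m < η t ω y} ≤ δ y := by
    intro y
    obtain ⟨x, hxy, -, -, hlt⟩ := exists_slow_site hpc hp1 hlim y y (lt_add_one c)
    obtain ⟨r, hr0, hr⟩ := ENNReal.lt_iff_exists_nnreal_btwn.1 (hδ y)
    obtain ⟨m, hm⟩ := h.exists_forall_measure_lt_le hp hxy hlt
      (show (0 : ℝ) < r by exact_mod_cast hr0)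
    refine ⟨m, fun t => le_trans ?_ hr.le⟩
    rw [← ENNReal.ofReal_coe_nnreal, ← ENNReal.ofReal_toReal (measure_ne_top P _)]
    exact ENNReal.ofReal_le_ofReal (hm t)
  choose m hm using hsite
  refine ⟨Set.univ.pi fun y => Set.Iic (m y),
    isCompact_univ_pi fun y => (Set.finite_Iic _).isCompact, ?_⟩
  rintro _ ⟨t, -, rfl⟩
  have hcompl : (Set.univ.pi fun y => Set.Iic (m y))ᶜ = ⋃ y, {ξ : Config | m y < ξ y} := by
    ext ξ
    simp [Set.mem_pi, -Set.pi_univ_Iic]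
  rw [hcompl]
  refine (measure_iUnion_le _).trans (le_trans (ENNReal.tsum_le_tsum fun y => ?_) hsum.le)
  have hmeas : MeasurableSet {ξ : Config | m y < ξ y} :=
    measurableSet_lt measurable_const (measurable_pi_apply y)
  change P.map (η t) _ ≤ _
  rw [Measure.map_apply (h.measurable_config t) hmeas]
  exact hm y t

/-- Time tends to infinity first, with the window fixed; only afterwards is the source sent along
sites whose rates tend to `c`. By locality the tandem law enters solely through the sites of `A`. -/
theorem IsZeroRangeProcess.dominatedBy_of_tendsto (h : IsZeroRangeProcess p ℱ N η P) (hc : 0 < c)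
    (hpc : ∀ x, c < p x) (hp1 : ∀ x, p x ≤ 1) (hlim : liminf p atBot = c)
    {μ : ProbabilityMeasure Config} {τ : ℕ → ℝ≥0} (hτ : Tendsto τ atTop atTop)
    (hμ : Tendsto (fun n => h.law (τ n)) atTop (𝓝 μ)) :
    DominatedBy μ (productMeasure p c) := by
  intro f₀ hf₀ hbdd hdep
  obtain ⟨C₀, hC₀⟩ := hbdd
  obtain ⟨A, hA⟩ := hdep
  have hp : ∀ z, 0 < p z := fun z => hc.trans (hpc z)
  have hprob : ∀ z, IsProbabilityMeasure (geometricLaw (c / p z)) := fun z =>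
    isProbabilityMeasure_geometricLaw (div_nonneg hc.le (hp z).le)
      ((div_lt_one (hp z)).2 (hpc z))
  have hprod : productMeasure p c = Measure.infinitePi fun z => geometricLaw (c / p z) := rfl
  -- The shift by `C₀` makes the test function nonnegative, as the comparison requires.
  set f : Config → ℝ := fun ξ => f₀ ξ + C₀ with hf
  set C := 2 * C₀ with hC
  have hfm : ∀ ξ, f ξ ∈ Set.Icc 0 C := fun ξ => by
    have := abs_le.1 (hC₀ ξ)
    constructor <;> simp only [hf, hC] <;> linarith
  have hfmono : Monotone f := fun ξ ζ hξ => add_le_add_left (hf₀ hξ) C₀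
  have hfA : DependsOn f (A : Set ℤ) := fun ξ ζ hξ => by simp only [hf, hA hξ]
  have hf₀c := continuous_of_dependsOn hA
  have hfc := continuous_of_dependsOn hfA
  have hint : ∀ (κ : Measure Config) [IsProbabilityMeasure κ], Integrable f₀ κ := fun κ _ =>
    Integrable.of_mem_Icc (-C₀) C₀ hf₀c.measurable.aemeasurable
      (ae_of_all _ fun ξ => abs_le.1 (hC₀ ξ))
  suffices hmain : ∫ ξ, f ξ ∂(μ : Measure Config) ≤ ∫ ξ, f ξ ∂(productMeasure p c) by
    have : IsProbabilityMeasure (productMeasure p c) := by rw [hprod]; infer_instance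
    simp only [hf] at hmain
    rw [integral_add (hint _) (integrable_const _), integral_add (hint _) (integrable_const _)]
      at hmain
    simpa using hmain
  have hconv : Tendsto (fun n => ∫ ω, f (η (τ n) ω) ∂P) atTop
      (𝓝 (∫ ξ, f ξ ∂(μ : Measure Config))) := by
    have h1 := ProbabilityMeasure.tendsto_iff_forall_integral_tendsto.1 hμ
      (BoundedContinuousFunction.ofNormedAddCommGroup f hfc C fun ξ => by
        rw [Real.norm_eq_abs, abs_of_nonneg (hfm ξ).1]
        exact (hfm ξ).2)
    refine h1.congr fun n => ?_
    exact integral_map (h.measurable_config _).aemeasurable hfc.aestronglyMeasurable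
  obtain ⟨K, hK⟩ := A.finite_toSet.bddAbove
  obtain ⟨a, ha⟩ := A.finite_toSet.bddBelow
  have hbound : ∀ v, c < v → ∃ w, c < w ∧ w < v ∧ ∫ ξ, f ξ ∂(μ : Measure Config) ≤
      ∫ ξ, f (extendByZero A ξ) ∂(Measure.pi fun y : A => geometricLaw (w / p y)) := by
    intro v hv
    obtain ⟨x, hxa, hxK, hxv, hlt⟩ := exists_slow_site hpc hp1 hlim a K hv
    refine ⟨p x, hpc x, hxv, ?_⟩
    have hAW : A ⊆ Finset.Ioc x K := fun z hz =>
      Finset.mem_Ioc.2 ⟨hxa.trans_le (ha hz), hK hz⟩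
    rw [← integral_tandemLaw_of_dependsOn hp hlt hfA hAW]
    refine le_of_forall_pos_le_add fun ε hε => le_of_tendsto hconv ?_
    filter_upwards [hτ.eventually (h.eventually_integral_le hp hxK hlt
      (hfmono.comp (extendByZero_monotone _)) (fun ξ => hfm _) hε)] with n hn
    simpa only [Function.comp_apply, extendByZero_restrict hfA hAW] using hn
  rw [hprod, integral_infinitePi_of_dependsOn hfA subset_rfl]
  have hcont := tendsto_integral_pi_geometricLaw (q := fun y : A => p y) hc (fun y => hpc y)
    (g := fun ξ => f (extendByZero A ξ)) (fun ξ => hfm _)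
  choose w hw using fun n : ℕ => hbound (c + 1 / (n + 1)) (by
    have : (0 : ℝ) < 1 / (n + 1) := by positivity
    linarith)
  have hwc : Tendsto w atTop (𝓝 c) := by
    refine tendsto_of_tendsto_of_tendsto_of_le_of_le tendsto_const_nhds ?_
      (fun n => (hw n).1.le) (fun n => (hw n).2.1.le)
    simpa using (tendsto_one_div_add_atTop_nhds_zero_nat (𝕜 := ℝ)).const_add c
  exact ge_of_tendsto' (hcont.comp hwc) fun n => (hw n).2.2

end Main

end ZeroRange

theorem proposition2p2
    {c : ℝ} (hc : 0 < c) {p : ℤ → ℝ}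
    (hpc : ∀ x, c < p x) (hp1 : ∀ x, p x ≤ 1) (hlim : liminf p atBot = c)
    (ν : ProbabilityMeasure ZeroRange.Config)
    {Ω : Type*} [mΩ : MeasurableSpace Ω] {P : Measure Ω} [IsProbabilityMeasure P]
    {ℱ : Filtration ℝ≥0 mΩ} {N : ℤ → ℝ≥0 → Ω → ℕ} {η : ℝ≥0 → Ω → ZeroRange.Config}
    (h : ZeroRange.IsZeroRangeProcess p ℱ N η P) (hν : h.law 0 = ν) :
    IsTightMeasureSet {m : Measure ZeroRange.Config | ∃ t : ℝ≥0, 0 < t ∧ m = h.law t} ∧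
    (∀ (μ : ProbabilityMeasure ZeroRange.Config) (τ : ℕ → ℝ≥0), Tendsto τ atTop atTop →
      Tendsto (fun n => h.law (τ n)) atTop (𝓝 μ) →
      ZeroRange.DominatedBy μ (ZeroRange.productMeasure p c)) ∧
    ((∀ t : ℝ≥0, h.law t = ν) →
      ZeroRange.DominatedBy ν (ZeroRange.productMeasure p c)) := by
  refine ⟨h.isTightMeasureSet hc hpc hp1 hlim,
    fun μ τ hτ hμ => h.dominatedBy_of_tendsto hc hpc hp1 hlim hτ hμ, fun hinv => ?_⟩
  -- An invariant law is the limit of its own constant evolution.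
  refine h.dominatedBy_of_tendsto hc hpc hp1 hlim (τ := fun n => (n : ℝ≥0))
    tendsto_natCast_atTop_atTop ?_
  simp only [hinv]
  exact tendsto_const_nhds
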